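/- **Theorem 3.2.** Let $M$ be a smooth manifold of odd dimension and $\mathcal{TM}=TM\oplus T^*M$, with the neutral metric $g((X,\alpha),(Y,\beta))=\tfrac12(\alpha(Y)+\beta(X))$, the length $\|u\|_g=|g(u,u)|^{1/2}$, the induced map $\flat_g:\mathcal{TM}\to\mathcal{TM}^*$, $\flat_g(u)=g(u,\cdot)$, and the Courant bracket $$[\![(X,\alpha),(Y,\beta)]\!]=\bigl([X,Y],\;L_X\beta-L_Y\alpha-\tfrac12 d(i_X\beta-i_Y\alpha)\bigr).$$ Let $\mathcal F$ be a smooth bundle endomorphism of $\mathcal{TM}$ with transpose $\mathcal F^t$ on $\mathcal{TM}^*$, let $\mathcal Z$ be a smooth vector field and $\xi$ a smooth 1-form on $M$, and put $\mathfrak Z(X,\alpha)=(\xi(X)\mathcal Z,\alpha(\mathcal Z)\xi)$ and $$\mathcal N_{\mathcal F}(e_1,e_2)=[\![\mathcal Fe_1,\mathcal Fe_2]\!]-\mathcal F\bigl([\![\mathcal Fe_1,e_2]\!]+[\![e_1,\mathcal Fe_2]\!]\bigr)+\mathcal F^2[\![e_1,e_2]\!].$$ The triple $(\mathcal F,\mathcal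 Z,\xi)$ is a *generalized almost para-contact structure* if $g(\mathcal Fu,v)+g(u,\mathcal Fv)=0$ for all $u,v$, $\xi(\mathcal Z)=1$, $\mathcal F(\mathcal Z,0)=\mathcal F(0,\xi)=0$ and $\mathcal F^2=\mathcal I-\mathfrak Z$. It is a *generalized normal para-contact structure* if in addition the corresponding translation-invariant generalized almost paracomplex structure $\mathcal J$ on $M\times\mathbb R$, $$\mathcal J\bigl(X+f\tfrac{\partial}{\partial t},\,\alpha+h\,dt\bigr)=\mathcal F(X,\alpha)+h(\mathcal Z,0)-f(0,\xi)+\bigl(-\alpha(\mathcal Z)\tfrac{\partial}{\partial t},\,\xi(X)\,dt\bigr),$$ is integrable, i.e. $[\![\mathcal Je_1,\mathcal Je_2]\!]-\mathcal J([\![\mathcal Je_1,e_2]\!]+[\![e_1,\mathcal Je_2]\!])+[\![e_1,e_2]\!]=0$ for all smooth sections $e_1,e_2$ of $T(M\times\mathbb R)\oplus T^*(M\times\mathbb R)$. Then $(\mathcal F,\mathcal Z,\xi)$ is a generalized normal para-contact structure if and only if the following conditions hold. 1. $\mathcal F^2=\mathcal I-\mathfrak Z$, and $\mathcal N_{\mathcal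 F}((X,\alpha),(Y,\beta))=-\mathfrak Z[\![(X,\alpha),(Y,\beta)]\!]$ for all $(X,\alpha),(Y,\beta)\in\Gamma(\operatorname{im}\mathcal F)$. 2. $\|\mathcal Z\oplus\xi\|_g=1$, and $[\![(\mathcal Z,0),\mathcal F(X,\alpha)]\!]=\mathcal F(L_{\mathcal Z}X,L_{\mathcal Z}\alpha)$ for all $(X,\alpha)\in\Gamma(\operatorname{im}\mathcal F)$. 3. $\flat_g\circ\mathcal F+\mathcal F^t\circ\flat_g=0$, $\mathcal F\circ\mathfrak Z=0$, and $[\![\mathcal F(X,\alpha),(0,\xi)]\!]=\mathcal F(0,L_X\xi)$ for all $(X,\alpha)\in\Gamma(\operatorname{im}\mathcal F)$. Here $\Gamma(\operatorname{im}\mathcal F)$ denotes the smooth sections of $\mathcal{TM}$ with values in the image of $\mathcal F$. -/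

import Mathlib

open scoped Manifold ContDiff Bundle

noncomputable section

namespace GenParacontact

section Courant

variable {E : Type*} [NormedAddCommGroup E] [NormedSpace ℝ E]
  {H : Type*} [TopologicalSpace H] (I : ModelWithCorners ℝ E H)
  {M : Type*} [TopologicalSpace M] [ChartedSpace H M]

/-- The cotangent space of `M` at `x`. -/
abbrev CotangentSpace (x : M) : Type _ := TangentSpace I x →L[ℝ] ℝ

/-- The fibre at `x` of the big tangent bundle `TM ⊕ T*M`. -/
abbrev BigTangent (x : M) : Type _ := TangentSpace I x × CotangentSpace I x

/-- Smoothness of a section of `TM ⊕ T*M`, the direct sum of the tangent bundle and of its dual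
(the bundle of continuous linear maps into the trivial line bundle). -/
def IsSmoothSection [IsManifold I ∞ M] (e : ∀ x : M, BigTangent I x) : Prop :=
  ContMDiff I (I.prod 𝓘(ℝ, E × (E →L[ℝ] ℝ))) ∞
    (fun x => Bundle.TotalSpace.mk' (E × (E →L[ℝ] ℝ)) (E := fun y : M => BigTangent I y) x (e x))

/-- Smoothness of a bundle endomorphism of `TM ⊕ T*M` over the identity of `M`, seen as a section
of the bundle `Hom (TM ⊕ T*M, TM ⊕ T*M)`. -/
def IsSmoothEndo [IsManifold I ∞ M] (A : ∀ x : M, BigTangent I x →L[ℝ] BigTangent I x) : Prop :=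
  ContMDiff I (I.prod 𝓘(ℝ, (E × (E →L[ℝ] ℝ)) →L[ℝ] (E × (E →L[ℝ] ℝ)))) ∞
    (fun x => Bundle.TotalSpace.mk' ((E × (E →L[ℝ] ℝ)) →L[ℝ] (E × (E →L[ℝ] ℝ)))
      (E := fun y : M => BigTangent I y →L[ℝ] BigTangent I y) x (A x))

/-- The differential `df` of a real function. -/
def differential (f : M → ℝ) (x : M) : CotangentSpace I x :=
  mfderiv I 𝓘(ℝ, ℝ) f x

/-- The 1-form `α` read in the preferred chart at `x₀`: its pullback by the inverse of the chart. -/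
def oneFormInChart (α : ∀ x : M, CotangentSpace I x) (x₀ : M) : E → E →L[ℝ] ℝ := fun y =>
  (α ((extChartAt I x₀).symm y)).comp
    (mfderivWithin 𝓘(ℝ, E) I (extChartAt I x₀).symm (Set.range I) y)

/-- The exterior derivative of a 1-form, `dα (X, Y) = X (α Y) - Y (α X) - α [X, Y]`, computed in
the preferred chart: there `(dα)(u, v) = (∂_u α)(v) - (∂_v α)(u)`. The 1-form
`extD I α x u` is the interior product `i_u dα` at `x`. -/
def extD (α : ∀ x : M, CotangentSpace I x) (x : M)
    (u : TangentSpace I x) : CotangentSpace I x :=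
  let φ : TangentSpace I x →L[ℝ] E := mfderiv I 𝓘(ℝ, E) (extChartAt I x) x
  let D : E →L[ℝ] E →L[ℝ] ℝ :=
    fderivWithin ℝ (oneFormInChart I α x) (Set.range I) (extChartAt I x x)
  (D (φ u) - D.flip (φ u)).comp φ

/-- The Lie derivative of a 1-form along a vector field, by Cartan's formula
`L_X β = i_X dβ + d (i_X β)`. -/
def lieForm (X : ∀ x : M, TangentSpace I x) (β : ∀ x : M, CotangentSpace I x) (x : M) :
    CotangentSpace I x :=
  extD I β x (X x) + differential I (fun y => β y (X y)) x

/-- The Courant bracket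
`⟦(X, α), (Y, β)⟧ = [X, Y] + L_X β - L_Y α - ½ d (i_X β - i_Y α)`. -/
def courant (e₁ e₂ : ∀ x : M, BigTangent I x) (x : M) : BigTangent I x :=
  (VectorField.mlieBracket I (fun y => (e₁ y).1) (fun y => (e₂ y).1) x,
    lieForm I (fun y => (e₁ y).1) (fun y => (e₂ y).2) x
      - lieForm I (fun y => (e₂ y).1) (fun y => (e₁ y).2) x
      - (1 / 2 : ℝ) •
        differential I (fun y => (e₂ y).2 (e₁ y).1 - (e₁ y).2 (e₂ y).1) x)

/-- The componentwise Lie derivative `(L_Z X, L_Z α)`, where `L_Z X = [Z, X]`. -/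
def lieBig (Z : ∀ x : M, TangentSpace I x) (e : ∀ x : M, BigTangent I x) (x : M) :
    BigTangent I x :=
  (VectorField.mlieBracket I Z (fun y => (e y).1) x, lieForm I Z (fun y => (e y).2) x)

/-- The section `A e` for a bundle endomorphism `A` and a section `e`. -/
def applyEndo (A : ∀ x : M, BigTangent I x →L[ℝ] BigTangent I x)
    (e : ∀ x : M, BigTangent I x) (x : M) : BigTangent I x :=
  A x (e x)

/-- The Nijenhuis operator
`N_A (e₁, e₂) = ⟦A e₁, A e₂⟧ - A (⟦A e₁, e₂⟧ + ⟦e₁, A e₂⟧) + A² ⟦e₁, e₂⟧`. -/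
def nijenhuis (A : ∀ x : M, BigTangent I x →L[ℝ] BigTangent I x)
    (e₁ e₂ : ∀ x : M, BigTangent I x) (x : M) : BigTangent I x :=
  courant I (applyEndo I A e₁) (applyEndo I A e₂) x
    - A x (courant I (applyEndo I A e₁) e₂ x + courant I e₁ (applyEndo I A e₂) x)
    + A x (A x (courant I e₁ e₂ x))

/-- The paracomplex integrability condition: `⟦J e₁, J e₂⟧ - J (⟦J e₁, e₂⟧ + ⟦e₁, J e₂⟧) + ⟦e₁, e₂⟧`
vanishes for all smooth sections `e₁`, `e₂` of the big tangent bundle. -/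
def IsIntegrable [IsManifold I ∞ M] (J : ∀ x : M, BigTangent I x →L[ℝ] BigTangent I x) : Prop :=
  ∀ e₁ e₂ : ∀ x : M, BigTangent I x, IsSmoothSection I e₁ → IsSmoothSection I e₂ → ∀ x : M,
    courant I (applyEndo I J e₁) (applyEndo I J e₂) x
      - J x (courant I (applyEndo I J e₁) e₂ x + courant I e₁ (applyEndo I J e₂) x)
      + courant I e₁ e₂ x = 0

/-- The neutral metric `g ((X, α), (Y, β)) = ½ (α(Y) + β(X))` of `TM ⊕ T*M`. -/
def metric {x : M} (a b : BigTangent I x) : ℝ :=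
  (1 / 2) * (a.2 b.1 + b.2 a.1)

/-- The length `‖a‖_g = |g (a, a)|^½` with respect to the neutral metric. -/
def metricNorm {x : M} (a : BigTangent I x) : ℝ :=
  Real.sqrt |metric I a a|

/-- Evaluation of covectors at a tangent vector, `α ↦ α(v)`. -/
def evalAt {x : M} (v : TangentSpace I x) : CotangentSpace I x →L[ℝ] ℝ :=
  (ContinuousLinearMap.apply ℝ ℝ : E →L[ℝ] (E →L[ℝ] ℝ) →L[ℝ] ℝ) v

@[simp] theorem evalAt_apply {x : M} (v : TangentSpace I x) (α : CotangentSpace I x) :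
    evalAt I v α = α v := rfl

/-- The isomorphism `♭_g` from `TM ⊕ T*M` to its dual: `♭_g a = g (a, ·)`. -/
def flat {x : M} (a : BigTangent I x) : BigTangent I x →L[ℝ] ℝ :=
  (1 / 2 : ℝ) • (a.2.comp (ContinuousLinearMap.fst ℝ _ _)
    + (evalAt I a.1).comp (ContinuousLinearMap.snd ℝ _ _))

theorem flat_apply {x : M} (a b : BigTangent I x) : flat I a b = metric I a b := by
  simp [flat, metric, mul_add]

/-- The transpose `A^t φ = φ ∘ A` of an endomorphism of a fibre, acting on the dual fibre. -/
def transpose {x : M} (A : BigTangent I x →L[ℝ] BigTangent I x) (φ : BigTangent I x →L[ℝ] ℝ) :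
    BigTangent I x →L[ℝ] ℝ :=
  φ.comp A

/-- The endomorphism `𝔷 = Z ⊙ ξ` of `TM ⊕ T*M`: `𝔷 (X, α) = (ξ(X) Z, α(Z) ξ)`. -/
def frakZ (Z : ∀ x : M, TangentSpace I x) (ξ : ∀ x : M, CotangentSpace I x) (x : M) :
    BigTangent I x →L[ℝ] BigTangent I x :=
  ((ξ x).smulRight (Z x)).prodMap ((evalAt I (Z x)).smulRight (ξ x))

theorem frakZ_apply (Z : ∀ x : M, TangentSpace I x) (ξ : ∀ x : M, CotangentSpace I x) (x : M)
    (a : BigTangent I x) : frakZ I Z ξ x a = (ξ x a.1 • Z x, a.2 (Z x) • ξ x) := by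
  rfl

/-- Smooth sections of the image of a bundle endomorphism. -/
def IsSectionOfImage [IsManifold I ∞ M] (A : ∀ x : M, BigTangent I x →L[ℝ] BigTangent I x)
    (e : ∀ x : M, BigTangent I x) : Prop :=
  IsSmoothSection I e ∧ ∀ x, e x ∈ Set.range (A x)

/-- `(F, Z, ξ)` is a generalized almost para-contact structure: `F + F* = 0` (adjoint with respect
to the neutral metric), `ξ(Z) = 1`, `F ξ = 0`, `F Z = 0` and `F² = I - Z ⊙ ξ`. -/
structure IsAlmostParacontact [IsManifold I ∞ M]
    (F : ∀ x : M, BigTangent I x →L[ℝ] BigTangent I x)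
    (Z : ∀ x : M, TangentSpace I x) (ξ : ∀ x : M, CotangentSpace I x) : Prop where
  smooth_endo : IsSmoothEndo I F
  smooth_section : IsSmoothSection I (fun x => (Z x, ξ x))
  skew : ∀ x (a b : BigTangent I x), metric I (F x a) b + metric I a (F x b) = 0
  pairing : ∀ x, ξ x (Z x) = 1
  apply_form : ∀ x, F x (0, ξ x) = 0
  apply_vector : ∀ x, F x (Z x, 0) = 0
  sq : ∀ x, (F x).comp (F x) = ContinuousLinearMap.id ℝ _ - frakZ I Z ξ x

end Courant

section Product

variable {E : Type*} [NormedAddCommGroup E] [NormedSpace ℝ E]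
  {H : Type*} [TopologicalSpace H] (I : ModelWithCorners ℝ E H)
  {M : Type*} [TopologicalSpace M] [ChartedSpace H M]

/-- The tangent space of `M × ℝ` at `p` is `T_{p.1} M × ℝ`. This is the projection
`(X + f ∂_t, α + g dt) ↦ (X, α)` of the big tangent space of `M × ℝ` to that of `M`. -/
def projBig (p : M × ℝ) :
    BigTangent (I.prod 𝓘(ℝ, ℝ)) p →L[ℝ] BigTangent I p.1 :=
  ContinuousLinearMap.prodMap (ContinuousLinearMap.fst ℝ E ℝ)
    ((ContinuousLinearMap.inl ℝ E ℝ).precomp ℝ)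

/-- The inclusion `(X, α) ↦ (X + 0 ∂_t, α + 0 dt)`. -/
def inclBig (p : M × ℝ) :
    BigTangent I p.1 →L[ℝ] BigTangent (I.prod 𝓘(ℝ, ℝ)) p :=
  ContinuousLinearMap.prodMap (ContinuousLinearMap.inl ℝ E ℝ)
    ((ContinuousLinearMap.fst ℝ E ℝ).precomp ℝ)

/-- The vector `∂_t = d/dt` of `M × ℝ`, in the big tangent space. -/
def bigDdt (p : M × ℝ) : BigTangent (I.prod 𝓘(ℝ, ℝ)) p :=
  (((0, 1) : E × ℝ), 0)

/-- The covector `dt` of `M × ℝ`, in the big tangent space. -/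
def bigDt (p : M × ℝ) : BigTangent (I.prod 𝓘(ℝ, ℝ)) p :=
  (0, ContinuousLinearMap.snd ℝ E ℝ)

/-- The functional `(X + f ∂_t, α + g dt) ↦ f`. -/
def coeffDdt (p : M × ℝ) : BigTangent (I.prod 𝓘(ℝ, ℝ)) p →L[ℝ] ℝ :=
  (ContinuousLinearMap.snd ℝ E ℝ).comp (ContinuousLinearMap.fst ℝ (E × ℝ) ((E × ℝ) →L[ℝ] ℝ))

/-- The functional `(X + f ∂_t, α + g dt) ↦ g`. -/
def coeffDt (p : M × ℝ) : BigTangent (I.prod 𝓘(ℝ, ℝ)) p →L[ℝ] ℝ :=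
  (ContinuousLinearMap.apply ℝ ℝ ((0, 1) : E × ℝ)).comp
    (ContinuousLinearMap.snd ℝ (E × ℝ) ((E × ℝ) →L[ℝ] ℝ))

/-- The generalized almost paracomplex structure on `M × ℝ` that corresponds to `(F, Z, ξ)`. It is
invariant under translations of `t`, and
`J (X + f ∂_t, α + g dt) = F (X, α) + g (Z, 0) - f (0, ξ) + (-α(Z) ∂_t, ξ(X) dt)`.
In terms of classical tensors, `F = (a, P, σ)` is replaced by `(a, P - Z ∧ ∂_t, σ + ξ ∧ dt)`. With
these signs `J` is skew for the neutral metric and `J² = I`, `J ∂_t = -ξ` and `J dt = Z`; the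
variant with `J ∂_t = ξ` and `J dt = -Z` is the image of this one under `t ↦ -t`. -/
def productEndo (F : ∀ x : M, BigTangent I x →L[ℝ] BigTangent I x)
    (Z : ∀ x : M, TangentSpace I x) (ξ : ∀ x : M, CotangentSpace I x) (p : M × ℝ) :
    BigTangent (I.prod 𝓘(ℝ, ℝ)) p →L[ℝ] BigTangent (I.prod 𝓘(ℝ, ℝ)) p :=
  (inclBig I p).comp ((F p.1).comp (projBig I p))
    + (coeffDt I p).smulRight (inclBig I p (Z p.1, 0))
    - (coeffDdt I p).smulRight (inclBig I p (0, ξ p.1))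
    - (((evalAt I (Z p.1)).comp
        ((ContinuousLinearMap.snd ℝ _ _).comp (projBig I p))).smulRight (bigDdt I p))
    + (((ξ p.1).comp ((ContinuousLinearMap.fst ℝ _ _).comp (projBig I p))).smulRight (bigDt I p))

/-- `(F, Z, ξ)` is a generalized normal para-contact structure: it is a generalized almost
para-contact structure and the corresponding generalized almost paracomplex structure on `M × ℝ` is
integrable. -/
def IsNormalParacontact [IsManifold I ∞ M]
    (F : ∀ x : M, BigTangent I x →L[ℝ] BigTangent I x)
    (Z : ∀ x : M, TangentSpace I x) (ξ : ∀ x : M, CotangentSpace I x) : Prop :=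
  IsAlmostParacontact I F Z ξ ∧ IsIntegrable (I.prod 𝓘(ℝ, ℝ)) (productEndo I F Z ξ)

end Product

end GenParacontact

end

/-
The structure `J` on `M × ℝ` is skew for the neutral metric and satisfies `J² = 1`. Its torsion
therefore depends only on the pointwise values of its arguments and is a skew bilinear `T` with
`T(J a, b) = -J T(a, b)`; this is checked on 1-jets of sections in a chart, where the Courant
bracket is an explicit bilinear expression. As the `J`-stable span of the translation-invariant
sections of `im F` together with `∂_t` and `dt` is the whole fibre, integrability only has to be
tested on pairs of these. The pairs with an entry in `im F` give the three bracket equations. The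
pair `(∂_t, dt)` gives `⟦(Z, 0), (0, ξ)⟧ = 0`, that is `i_Z dξ = 0`, which follows from
`ξ(Z) = 1` and the equation `⟦(Z, 0), F e⟧ = F (L_Z e)`: the latter makes `L_Z` preserve `ker ξ`.
-/
noncomputable section

namespace GenParacontact

open Set Filter
open scoped Topology

section JetAlgebra

variable {E V : Type*} [NormedAddCommGroup E] [NormedSpace ℝ E] [NormedAddCommGroup V]
  [NormedSpace ℝ V]

/-- The 1-jets at a point of maps `E → V`: a value together with a derivative. -/
abbrev Jet (E V : Type*) [NormedAddCommGroup E] [NormedSpace ℝ E] [NormedAddCommGroup V]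
    [NormedSpace ℝ V] : Type _ := V × (E →L[ℝ] V)

/-- The Courant bracket of two sections of a trivial bundle with fibre `V`, anchor `ρ`, coanchor
`ι` and metric `B`, at a point, in terms of the 1-jets of the sections there. -/
def jetBracket (ρ : V →L[ℝ] E) (ι : (E →L[ℝ] ℝ) →L[ℝ] V) (B : V →ₗ[ℝ] V →L[ℝ] ℝ) :
    Jet E V →ₗ[ℝ] Jet E V →ₗ[ℝ] V :=
  LinearMap.mk₂ ℝ
    (fun a b => b.2 (ρ a.1) - a.2 (ρ b.1) + ι ((B b.1).comp a.2 - (B a.1).comp b.2))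
    (fun a a' b => by
      simp only [Prod.fst_add, Prod.snd_add, map_add, map_sub, add_apply,
        ContinuousLinearMap.comp_add, ContinuousLinearMap.add_comp]
      abel)
    (fun c a b => by
      simp only [Prod.smul_fst, Prod.smul_snd, map_smul, map_sub, smul_apply,
        ContinuousLinearMap.comp_smul, ContinuousLinearMap.smul_comp, smul_add, smul_sub])
    (fun a b b' => by
      simp only [Prod.fst_add, Prod.snd_add, map_add, map_sub, add_apply,
        ContinuousLinearMap.comp_add, ContinuousLinearMap.add_comp]
      abel)
    (fun c a b => by
      simp only [Prod.smul_fst, Prod.smul_snd, map_smul, map_sub, smul_apply,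
        ContinuousLinearMap.comp_smul, ContinuousLinearMap.smul_comp, smul_add, smul_sub])

/-- The 1-jet of `z ↦ J z (e z)` in terms of the 1-jet of `e`, for an endomorphism-valued map with
value `J` and derivative `D`. -/
def prolong (J : V →L[ℝ] V) (D : E →L[ℝ] V →L[ℝ] V) : Jet E V →ₗ[ℝ] Jet E V where
  toFun a := (J a.1, J.comp a.2 + D.flip a.1)
  map_add' a b := by
    refine Prod.ext (map_add J _ _) ?_
    simp only [Prod.fst_add, Prod.snd_add, ContinuousLinearMap.comp_add, map_add]
    abel
  map_smul' c a := by
    refine Prod.ext (map_smul J _ _) ?_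
    simp only [Prod.smul_fst, Prod.smul_snd, ContinuousLinearMap.comp_smul, map_smul, smul_add,
      RingHom.id_apply]

variable (ρ : V →L[ℝ] E) (ι : (E →L[ℝ] ℝ) →L[ℝ] V) (B : V →ₗ[ℝ] V →L[ℝ] ℝ)
  (J : V →L[ℝ] V) (D : E →L[ℝ] V →L[ℝ] V)

/-- The expression `⟦J e₁, J e₂⟧ - J (⟦J e₁, e₂⟧ + ⟦e₁, J e₂⟧) + ⟦e₁, e₂⟧` at a point, in terms of
the 1-jets of `J`, `e₁` and `e₂` there. -/
def jetTorsion : Jet E V →ₗ[ℝ] Jet E V →ₗ[ℝ] V :=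
  (jetBracket ρ ι B).compl₁₂ (prolong J D) (prolong J D)
    - ((jetBracket ρ ι B).comp (prolong J D)
      + (jetBracket ρ ι B).compl₂ (prolong J D)).compr₂ J
    + jetBracket ρ ι B

/-- The restriction of `jetTorsion` to 1-jets with vanishing derivative. -/
def torsionForm : V →ₗ[ℝ] V →ₗ[ℝ] V :=
  (jetTorsion ρ ι B J D).compl₁₂ (LinearMap.inl ℝ V _) (LinearMap.inl ℝ V _)

theorem jetTorsion_apply (a b : Jet E V) :
    jetTorsion ρ ι B J D a b = jetBracket ρ ι B (prolong J D a) (prolong J D b)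
      - J (jetBracket ρ ι B (prolong J D a) b + jetBracket ρ ι B a (prolong J D b))
      + jetBracket ρ ι B a b := rfl

theorem jetBracket_swap (a b : Jet E V) : jetBracket ρ ι B a b = -jetBracket ρ ι B b a := by
  simp only [jetBracket, LinearMap.mk₂_apply, map_sub]
  abel

theorem jetTorsion_swap (a b : Jet E V) :
    jetTorsion ρ ι B J D a b = -jetTorsion ρ ι B J D b a := by
  simp only [jetTorsion_apply]
  rw [jetBracket_swap ρ ι B (prolong J D a) (prolong J D b),
    jetBracket_swap ρ ι B (prolong J D a) b, jetBracket_swap ρ ι B a (prolong J D b),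
    jetBracket_swap ρ ι B a b, ← neg_add, map_neg, add_comm (jetBracket ρ ι B b _)]
  abel

variable {ρ ι B J}

theorem jetTorsion_zero_left (hskew : ∀ a b, B (J a) b = -B a (J b)) (hsq : ∀ a, J (J a) = a)
    (L : E →L[ℝ] V) (b : Jet E V) : jetTorsion ρ ι B J D (0, L) b = 0 := by
  have bracket (M : E →L[ℝ] V) (c : Jet E V) :
      jetBracket ρ ι B (0, M) c = -M (ρ c.1) + ι ((B c.1).comp M) := by
    simp [jetBracket]
  have prolong_zero : prolong J D (0, L) = (0, J.comp L) := by simp [prolong]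
  have h₁ : (B (J b.1)).comp (J.comp L) = -(B b.1).comp L := by
    ext v; simp [hskew, hsq]
  have h₂ : (B (J b.1)).comp L = -(B b.1).comp (J.comp L) := by
    ext v; simp [hskew]
  have h₃ : (prolong J D b).1 = J b.1 := rfl
  simp only [jetTorsion_apply, prolong_zero, bracket, h₁, h₂, h₃, map_add, map_neg,
    ContinuousLinearMap.comp_apply, hsq]
  abel

theorem jetTorsion_eq_torsionForm (hskew : ∀ a b, B (J a) b = -B a (J b))
    (hsq : ∀ a, J (J a) = a) (a b : Jet E V) :
    jetTorsion ρ ι B J D a b = torsionForm ρ ι B J D a.1 b.1 := by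
  have drop_left (a b : Jet E V) :
      jetTorsion ρ ι B J D a b = jetTorsion ρ ι B J D (a.1, 0) b := by
    have ha : a = (a.1, 0) + (0, a.2) := by simp
    conv_lhs => rw [ha, map_add, LinearMap.add_apply, jetTorsion_zero_left D hskew hsq, add_zero]
  rw [drop_left, jetTorsion_swap, drop_left, ← jetTorsion_swap]
  rfl

theorem torsionForm_swap (a b : V) : torsionForm ρ ι B J D a b = -torsionForm ρ ι B J D b a :=
  jetTorsion_swap ..

end JetAlgebra

section Model

variable {E : Type*} [NormedAddCommGroup E] [NormedSpace ℝ E]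

/-- The fibre `E × E*` of the big tangent bundle of the normed space `E`. -/
abbrev ModelFibre (E : Type*) [NormedAddCommGroup E] [NormedSpace ℝ E] : Type _ :=
  E × (E →L[ℝ] ℝ)

/-- The map `♭_g : E × E* → (E × E*)*` of the neutral metric of the normed space `E`. -/
def modelFlat (E : Type*) [NormedAddCommGroup E] [NormedSpace ℝ E] :
    ModelFibre E →ₗ[ℝ] ModelFibre E →L[ℝ] ℝ where
  toFun a := flat 𝓘(ℝ, E) (x := (0 : E)) a
  map_add' a b := by
    refine ContinuousLinearMap.ext fun (v : ModelFibre E) => ?_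
    change 1 / 2 * ((a.2 v.1 + b.2 v.1) + v.2 (a.1 + b.1))
      = 1 / 2 * (a.2 v.1 + v.2 a.1) + 1 / 2 * (b.2 v.1 + v.2 b.1)
    rw [map_add]; ring
  map_smul' c a := by
    refine ContinuousLinearMap.ext fun (v : ModelFibre E) => ?_
    change 1 / 2 * (c * a.2 v.1 + v.2 (c • a.1)) = c * (1 / 2 * (a.2 v.1 + v.2 a.1))
    rw [map_smul, smul_eq_mul]; ring

/-- The Courant bracket over a normed space `E`, in terms of 1-jets at a point. -/
abbrev modelBracket (a b : Jet E (ModelFibre E)) : ModelFibre E :=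
  jetBracket (ContinuousLinearMap.fst ℝ E _) (ContinuousLinearMap.inr ℝ E _) (modelFlat E) a b

end Model

section Jets

variable {E : Type*} [NormedAddCommGroup E] [NormedSpace ℝ E]
  {H : Type*} [TopologicalSpace H] (I : ModelWithCorners ℝ E H)
  {M : Type*} [TopologicalSpace M] [ChartedSpace H M] [IsManifold I ∞ M]

/-- The fibre at `y` of the big tangent bundle, read in the preferred chart at `x₀`. -/
def readFibre (x₀ y : M) : BigTangent I y →L[ℝ] ModelFibre E :=
  ((trivializationAt E (TangentSpace I) x₀).continuousLinearMapAt ℝ y).prodMap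
    (((trivializationAt E (TangentSpace I) x₀).symmL ℝ y).precomp ℝ)

/-- A section of the big tangent bundle, read in the preferred chart at `x₀`. -/
def localRep (x₀ : M) (e : ∀ x : M, BigTangent I x) (z : E) : ModelFibre E :=
  readFibre I x₀ ((extChartAt I x₀).symm z) (e ((extChartAt I x₀).symm z))

/-- Differentiability at `x` of a section, read in the preferred chart at `x`. -/
def DiffAt (e : ∀ x : M, BigTangent I x) (x : M) : Prop :=
  DifferentiableAt ℝ (localRep I x e) (extChartAt I x x)

/-- The 1-jet at `x` of a section, read in the preferred chart at `x`, where the fibre at `x` is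
read as itself. -/
def jet (e : ∀ x : M, BigTangent I x) (x : M) : Jet E (ModelFibre E) :=
  (e x, fderiv ℝ (localRep I x e) (extChartAt I x x))

theorem readFibre_self (x : M) (v : BigTangent I x) : readFibre I x x v = v := by
  have h₁ : (trivializationAt E (TangentSpace I) x).continuousLinearMapAt ℝ x
      = ContinuousLinearMap.id ℝ E :=
    (TangentBundle.continuousLinearMapAt_trivializationAt (mem_chart_source H x)).trans
      mfderiv_extChartAt_self
  have h₂ : (trivializationAt E (TangentSpace I) x).symmL ℝ x = ContinuousLinearMap.id ℝ E :=
    (TangentBundle.symmL_trivializationAt (mem_chart_source H x)).trans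
      mfderivWithin_range_extChartAt_symm
  rw [readFibre, h₁, h₂]
  rfl

theorem readFibre_pairing {x y : M} (hy : y ∈ (chartAt H x).source) (v w : BigTangent I y) :
    (readFibre I x y v).2 (readFibre I x y w).1 = v.2 w.1 :=
  congrArg v.2 ((trivializationAt E (TangentSpace I) x).symmL_continuousLinearMapAt
    (by simpa using hy) w.1)

theorem localRep_self (x : M) (e : ∀ x : M, BigTangent I x) :
    localRep I x e (extChartAt I x x) = e x := by
  rw [localRep, extChartAt_to_inv, readFibre_self]

theorem trivializationAt_eq_readFibre {x₀ y : M} (hy : y ∈ (chartAt H x₀).source)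
    (v : BigTangent I y) :
    (trivializationAt (ModelFibre E) (fun y : M => BigTangent I y) x₀ ⟨y, v⟩).2
      = readFibre I x₀ y v := by
  have h : (trivializationAt E (TangentSpace I) x₀ ⟨y, v.1⟩).2
      = (trivializationAt E (TangentSpace I) x₀).continuousLinearMapAt ℝ y v.1 := by
    rw [Bundle.Trivialization.continuousLinearMapAt_apply,
      Bundle.Trivialization.coe_linearMapAt_of_mem _ (by simpa using hy)]
  refine Prod.ext h ?_
  ext w
  change ((Bundle.Trivial.trivialization M ℝ).continuousLinearMapAt ℝ y) _ = _
  simp [readFibre]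

variable {I} {e e₁ e₂ : ∀ x : M, BigTangent I x} {x : M}

theorem DiffAt.fst (he : DiffAt I e x) :
    HasFDerivAt (fun z => (localRep I x e z).1)
      ((ContinuousLinearMap.fst ℝ E (E →L[ℝ] ℝ)).comp (jet I e x).2) (extChartAt I x x) :=
  (ContinuousLinearMap.fst ℝ E (E →L[ℝ] ℝ)).hasFDerivAt.comp _ he.hasFDerivAt

theorem DiffAt.snd (he : DiffAt I e x) :
    HasFDerivAt (fun z => (localRep I x e z).2)
      ((ContinuousLinearMap.snd ℝ E (E →L[ℝ] ℝ)).comp (jet I e x).2) (extChartAt I x x) :=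
  (ContinuousLinearMap.snd ℝ E (E →L[ℝ] ℝ)).hasFDerivAt.comp _ he.hasFDerivAt

theorem DiffAt.pairing (h₁ : DiffAt I e₁ x) (h₂ : DiffAt I e₂ x) :
    HasFDerivAt (fun z => (localRep I x e₂ z).2 (localRep I x e₁ z).1)
      ((e₂ x).2.comp ((ContinuousLinearMap.fst ℝ E (E →L[ℝ] ℝ)).comp (jet I e₁ x).2)
        + ((ContinuousLinearMap.snd ℝ E (E →L[ℝ] ℝ)).comp (jet I e₂ x).2).flip (e₁ x).1)
      (extChartAt I x x) := by
  have := h₂.snd.clm_apply h₁.fst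
  rwa [localRep_self, localRep_self] at this

variable [I.Boundaryless]

omit [IsManifold I ∞ M] in
theorem eventually_extChartAt_symm_mem_source (x : M) :
    ∀ᶠ z in 𝓝 (extChartAt I x x), (extChartAt I x).symm z ∈ (chartAt H x).source := by
  filter_upwards [extChartAt_target_mem_nhds (I := I) x] with z hz
  simpa only [extChartAt_source] using (extChartAt I x).map_target hz

omit [IsManifold I ∞ M] in
theorem differentiableAt_comp_extChartAt_symm {V : Type*} [NormedAddCommGroup V]
    [NormedSpace ℝ V] {f : M → V} (hf : ContMDiffAt I 𝓘(ℝ, V) ∞ f x) :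
    DifferentiableAt ℝ (f ∘ (extChartAt I x).symm) (extChartAt I x x) := by
  have := (hf.mdifferentiableAt (by simp)).differentiableWithinAt_writtenInExtChartAt
  rwa [I.range_eq_univ, differentiableWithinAt_univ] at this

theorem diffAt_of_contMDiffAt
    (he : ContMDiffAt I (I.prod 𝓘(ℝ, ModelFibre E)) ∞
      (fun y => Bundle.TotalSpace.mk' (ModelFibre E) (E := fun y : M => BigTangent I y) y (e y))
      x) :
    DiffAt I e x := by
  have h := (Bundle.contMDiffAt_section (IB := I) x).1 he
  refine (differentiableAt_comp_extChartAt_symm h).congr_of_eventuallyEq ?_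
  filter_upwards [eventually_extChartAt_symm_mem_source x] with z hz
  exact (trivializationAt_eq_readFibre I hz _).symm

theorem IsSmoothSection.diffAt (he : IsSmoothSection I e) (x : M) : DiffAt I e x :=
  diffAt_of_contMDiffAt (he x)

theorem exists_diffAt (x : M) (v : BigTangent I x) :
    ∃ e : ∀ y : M, BigTangent I y, DiffAt I e x ∧ e x = v :=
  ⟨_, diffAt_of_contMDiffAt (FiberBundle.contMDiffAt_extend I (ModelFibre E)
    (V := fun y : M => BigTangent I y) v), FiberBundle.extend_apply_self _ _⟩

end Jets

section SmoothSections

variable {E : Type*} [NormedAddCommGroup E] [NormedSpace ℝ E] [FiniteDimensional ℝ E]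
  {H : Type*} [TopologicalSpace H] {I : ModelWithCorners ℝ E H}
  {M : Type*} [TopologicalSpace M] [ChartedSpace H M] [IsManifold I ∞ M]
  [T2Space M] [SigmaCompactSpace M]

theorem exists_smoothSection (x : M) (v : BigTangent I x) :
    ∃ e : ∀ y : M, BigTangent I y, IsSmoothSection I e ∧ e x = v := by
  classical
  let t : ∀ y : M, Set (BigTangent I y) := fun y => {w | ∀ h : y = x, w = h ▸ v}
  have convex (y : M) : Convex ℝ (t y) := by
    by_cases h : y = x
    · subst h
      simp [t]
    · simpa [t, h] using convex_univ
  have local_section (y : M) : ∃ U ∈ 𝓝 y, ∃ s : ∀ z : M, BigTangent I z,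
      ContMDiffOn I (I.prod 𝓘(ℝ, ModelFibre E)) ∞ (fun z => Bundle.TotalSpace.mk'
        (ModelFibre E) (E := fun y : M => BigTangent I y) z (s z)) U ∧ ∀ z ∈ U, s z ∈ t z := by
    by_cases h : y = x
    · subst h
      obtain ⟨U, hU, hsU⟩ := FiberBundle.exists_contMDiffOn_extend (k := ∞) I
        (ModelFibre E) (V := fun y : M => BigTangent I y) v
      refine ⟨U, hU, _, hsU, ?_⟩
      rintro z - rfl
      exact FiberBundle.extend_apply_self _ _
    · exact ⟨{x}ᶜ, isOpen_compl_singleton.mem_nhds h, fun _ => 0,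
        (Bundle.contMDiff_zeroSection ℝ (fun y : M => BigTangent I y)).contMDiffOn,
        fun z hz hzx => absurd hzx hz⟩
  obtain ⟨s, hs⟩ := exists_contMDiffSection_forall_mem_convex_of_local (n := ⊤) I
    (F_fiber := ModelFibre E) (fun y : M => BigTangent I y) t convex local_section
  exact ⟨s, s.contMDiff, hs x rfl⟩

end SmoothSections

section CourantInChart

variable {E : Type*} [NormedAddCommGroup E] [NormedSpace ℝ E]
  {H : Type*} [TopologicalSpace H] {I : ModelWithCorners ℝ E H}
  {M : Type*} [TopologicalSpace M] [ChartedSpace H M]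

theorem differential_eq_fderiv {f : M → ℝ} {x : M} {g : E → ℝ}
    (hg : DifferentiableAt ℝ g (extChartAt I x x))
    (hfg : f ∘ (extChartAt I x).symm =ᶠ[𝓝 (extChartAt I x x)] g) :
    differential I f x = fderiv ℝ g (extChartAt I x x) := by
  have hd := hg.congr_of_eventuallyEq hfg
  have hc : ContinuousAt f x := by
    refine (hd.continuousAt.comp (continuousAt_extChartAt (I := I) x)).congr ?_
    filter_upwards [extChartAt_source_mem_nhds (I := I) x] with y hy
    exact congrArg f ((extChartAt I x).left_inv hy)
  refine HasMFDerivAt.mfderiv ⟨hc, ?_⟩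
  rw [← hfg.fderiv_eq]
  exact hd.hasFDerivAt.hasFDerivWithinAt

variable [IsManifold I ∞ M] {x : M}

theorem mfderivWithin_extChartAt_symm_eq_symmL {z : E} (hz : z ∈ (extChartAt I x).target) :
    mfderivWithin 𝓘(ℝ, E) I (extChartAt I x).symm (range I) z
      = (trivializationAt E (TangentSpace I) x).symmL ℝ ((extChartAt I x).symm z) := by
  have h : (extChartAt I x).symm z ∈ (chartAt H x).source := by
    rw [← extChartAt_source I]; exact (extChartAt I x).map_target hz
  rw [TangentBundle.symmL_trivializationAt h, (extChartAt I x).right_inv hz]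

theorem inverse_mfderivWithin_extChartAt_symm {z : E} (hz : z ∈ (extChartAt I x).target) :
    (mfderivWithin 𝓘(ℝ, E) I (extChartAt I x).symm (range I) z).inverse
      = (trivializationAt E (TangentSpace I) x).continuousLinearMapAt ℝ
          ((extChartAt I x).symm z) := by
  have h : (extChartAt I x).symm z ∈ (chartAt H x).source := by
    rw [← extChartAt_source I]; exact (extChartAt I x).map_target hz
  rw [TangentBundle.continuousLinearMapAt_trivializationAt h]
  exact ContinuousLinearMap.inverse_eq (mfderivWithin_extChartAt_symm_comp_mfderiv_extChartAt hz)
    (mfderiv_extChartAt_comp_mfderivWithin_extChartAt_symm hz)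

variable [I.Boundaryless] {e e₁ e₂ : ∀ x : M, BigTangent I x}

theorem mpullbackWithin_eventuallyEq (e : ∀ x : M, BigTangent I x) (x : M) :
    VectorField.mpullbackWithin 𝓘(ℝ, E) I (extChartAt I x).symm (fun y => (e y).1) (range I)
      =ᶠ[𝓝 (extChartAt I x x)] fun z => (localRep I x e z).1 := by
  filter_upwards [extChartAt_target_mem_nhds (I := I) x] with z hz
  rw [VectorField.mpullbackWithin_apply, inverse_mfderivWithin_extChartAt_symm hz]
  rfl

theorem oneFormInChart_eventuallyEq (e : ∀ x : M, BigTangent I x) (x : M) :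
    oneFormInChart I (fun y => (e y).2) x
      =ᶠ[𝓝 (extChartAt I x x)] fun z => (localRep I x e z).2 := by
  filter_upwards [extChartAt_target_mem_nhds (I := I) x] with z hz
  rw [oneFormInChart, mfderivWithin_extChartAt_symm_eq_symmL hz]
  rfl

theorem pairing_eventuallyEq (e₁ e₂ : ∀ x : M, BigTangent I x) (x : M) :
    (fun y => (e₂ y).2 (e₁ y).1) ∘ (extChartAt I x).symm
      =ᶠ[𝓝 (extChartAt I x x)] fun z => (localRep I x e₂ z).2 (localRep I x e₁ z).1 := by
  filter_upwards [eventually_extChartAt_symm_mem_source x] with z hz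
  exact (readFibre_pairing I hz _ _).symm

theorem mlieBracket_eq_jet (h₁ : DiffAt I e₁ x) (h₂ : DiffAt I e₂ x) :
    VectorField.mlieBracket I (fun y => (e₁ y).1) (fun y => (e₂ y).1) x
      = ((jet I e₂ x).2 (e₁ x).1).1 - ((jet I e₁ x).2 (e₂ x).1).1 := by
  have bracket_in_chart : VectorField.lieBracketWithin ℝ
      (VectorField.mpullbackWithin 𝓘(ℝ, E) I (extChartAt I x).symm (fun y => (e₁ y).1) (range I))
      (VectorField.mpullbackWithin 𝓘(ℝ, E) I (extChartAt I x).symm (fun y => (e₂ y).1) (range I))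
      ((extChartAt I x).symm ⁻¹' univ ∩ range I) (extChartAt I x x)
      = ((jet I e₂ x).2 (e₁ x).1).1 - ((jet I e₁ x).2 (e₂ x).1).1 := by
    refine (EventuallyEq.lieBracketWithin_vectorField_eq_nhds (mpullbackWithin_eventuallyEq e₁ x)
      (mpullbackWithin_eventuallyEq e₂ x)).trans ?_
    rw [preimage_univ, univ_inter, I.range_eq_univ, VectorField.lieBracketWithin_univ,
      VectorField.lieBracket_eq]
    beta_reduce
    rw [h₁.fst.fderiv, h₂.fst.fderiv, localRep_self, localRep_self]
    rfl
  rw [← VectorField.mlieBracketWithin_univ, VectorField.mlieBracketWithin_apply]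
  refine Eq.trans ?_ bracket_in_chart
  rw [mfderiv_extChartAt_self]
  exact congrArg (fun A : E →L[ℝ] E => A _) ContinuousLinearMap.inverse_id

theorem extD_eq_jet (h : DiffAt I e x) (u v : E) :
    extD I (fun y => (e y).2) x u v = ((jet I e x).2 u).2 v - ((jet I e x).2 v).2 u := by
  have hD : fderivWithin ℝ (oneFormInChart I (fun y => (e y).2) x) (range I) (extChartAt I x x)
      = (ContinuousLinearMap.snd ℝ E (E →L[ℝ] ℝ)).comp (jet I e x).2 := by
    rw [I.range_eq_univ, fderivWithin_univ, (oneFormInChart_eventuallyEq e x).fderiv_eq,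
      h.snd.fderiv]
  change (fderivWithin ℝ (oneFormInChart I (fun y => (e y).2) x) (range I) (extChartAt I x x))
      (mfderiv I 𝓘(ℝ, E) (extChartAt I x) x u) (mfderiv I 𝓘(ℝ, E) (extChartAt I x) x v)
    - (fderivWithin ℝ (oneFormInChart I (fun y => (e y).2) x) (range I) (extChartAt I x x))
      (mfderiv I 𝓘(ℝ, E) (extChartAt I x) x v) (mfderiv I 𝓘(ℝ, E) (extChartAt I x) x u) = _
  rw [hD, mfderiv_extChartAt_self]
  rfl

theorem differential_pairing (h₁ : DiffAt I e₁ x) (h₂ : DiffAt I e₂ x) (v : E) :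
    differential I (fun y => (e₂ y).2 (e₁ y).1) x v
      = (e₂ x).2 ((jet I e₁ x).2 v).1 + ((jet I e₂ x).2 v).2 (e₁ x).1 := by
  have := h₁.pairing h₂
  rw [differential_eq_fderiv this.differentiableAt (pairing_eventuallyEq e₁ e₂ x), this.fderiv]
  rfl

theorem differential_pairing_sub (h₁ : DiffAt I e₁ x) (h₂ : DiffAt I e₂ x) (v : E) :
    differential I (fun y => (e₂ y).2 (e₁ y).1 - (e₁ y).2 (e₂ y).1) x v
      = ((e₂ x).2 ((jet I e₁ x).2 v).1 + ((jet I e₂ x).2 v).2 (e₁ x).1)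
      - ((e₁ x).2 ((jet I e₂ x).2 v).1 + ((jet I e₁ x).2 v).2 (e₂ x).1) := by
  have := (h₁.pairing h₂).sub (h₂.pairing h₁)
  rw [differential_eq_fderiv (f := fun y => (e₂ y).2 (e₁ y).1 - (e₁ y).2 (e₂ y).1)
    this.differentiableAt ((pairing_eventuallyEq e₁ e₂ x).sub (pairing_eventuallyEq e₂ e₁ x)),
    this.fderiv]
  rfl

theorem lieForm_eq_jet (h₁ : DiffAt I e₁ x) (h₂ : DiffAt I e₂ x) (v : E) :
    lieForm I (fun y => (e₁ y).1) (fun y => (e₂ y).2) x v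
      = ((jet I e₂ x).2 (e₁ x).1).2 v + (e₂ x).2 ((jet I e₁ x).2 v).1 := by
  refine (congrArg₂ (· + ·) (extD_eq_jet h₂ (e₁ x).1 v) (differential_pairing h₁ h₂ v)).trans ?_
  abel

theorem courant_eq_modelBracket (h₁ : DiffAt I e₁ x) (h₂ : DiffAt I e₂ x) :
    courant I e₁ e₂ x = modelBracket (jet I e₁ x) (jet I e₂ x) := by
  refine Prod.ext ((mlieBracket_eq_jet h₁ h₂).trans (add_zero _).symm)
    (ContinuousLinearMap.ext fun (v : E) => ?_)
  change lieForm I (fun y => (e₁ y).1) (fun y => (e₂ y).2) x v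
      - lieForm I (fun y => (e₂ y).1) (fun y => (e₁ y).2) x v
      - 1 / 2 * differential I (fun y => (e₂ y).2 (e₁ y).1 - (e₁ y).2 (e₂ y).1) x v
    = (((jet I e₂ x).2 (e₁ x).1).2 v - ((jet I e₁ x).2 (e₂ x).1).2 v)
        + (1 / 2 * ((e₂ x).2 ((jet I e₁ x).2 v).1 + ((jet I e₁ x).2 v).2 (e₂ x).1)
          - 1 / 2 * ((e₁ x).2 ((jet I e₂ x).2 v).1 + ((jet I e₂ x).2 v).2 (e₁ x).1))
  rw [lieForm_eq_jet h₁ h₂, lieForm_eq_jet h₂ h₁, differential_pairing_sub h₁ h₂]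
  ring

theorem courant_swap (h₁ : DiffAt I e₁ x) (h₂ : DiffAt I e₂ x) :
    courant I e₁ e₂ x = -courant I e₂ e₁ x := by
  rw [courant_eq_modelBracket h₁ h₂, courant_eq_modelBracket h₂ h₁]
  exact jetBracket_swap (E := E) (V := ModelFibre E) _ _ _ _ _

end CourantInChart

section Endomorphisms

variable {E : Type*} [NormedAddCommGroup E] [NormedSpace ℝ E]
  {H : Type*} [TopologicalSpace H] (I : ModelWithCorners ℝ E H)
  {M : Type*} [TopologicalSpace M] [ChartedSpace H M] [IsManifold I ∞ M]

/-- `Â` is a differentiable representation, in the preferred chart at `x`, of the endomorphism `A`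
of the big tangent bundle. -/
structure HasEndoRepAt (A : ∀ x : M, BigTangent I x →L[ℝ] BigTangent I x) (x : M)
    (Â : E → ModelFibre E →L[ℝ] ModelFibre E) : Prop where
  differentiableAt : DifferentiableAt ℝ Â (extChartAt I x x)
  eventually_apply : ∀ᶠ z in 𝓝 (extChartAt I x x), ∀ v : BigTangent I ((extChartAt I x).symm z),
    readFibre I x ((extChartAt I x).symm z) (A _ v)
      = Â z (readFibre I x ((extChartAt I x).symm z) v)

omit [IsManifold I ∞ M] in
/-- The expression `⟦J e₁, J e₂⟧ - J (⟦J e₁, e₂⟧ + ⟦e₁, J e₂⟧) + ⟦e₁, e₂⟧`. -/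
def torsion (J : ∀ x : M, BigTangent I x →L[ℝ] BigTangent I x) (e₁ e₂ : ∀ x : M, BigTangent I x)
    (x : M) : BigTangent I x :=
  courant I (applyEndo I J e₁) (applyEndo I J e₂) x
      - J x (courant I (applyEndo I J e₁) e₂ x + courant I e₁ (applyEndo I J e₂) x)
      + courant I e₁ e₂ x

variable {I} {A : ∀ x : M, BigTangent I x →L[ℝ] BigTangent I x} {x : M}
  {Â : E → ModelFibre E →L[ℝ] ModelFibre E} {e e₁ e₂ : ∀ x : M, BigTangent I x}

theorem HasEndoRepAt.apply_self (h : HasEndoRepAt I A x Â) (v : BigTangent I x) :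
    Â (extChartAt I x x) v = A x v := by
  have := h.eventually_apply.self_of_nhds
  rw [extChartAt_to_inv] at this
  simpa only [readFibre_self] using (this v).symm

theorem HasEndoRepAt.hasFDerivAt (h : HasEndoRepAt I A x Â) (he : DiffAt I e x) :
    HasFDerivAt (localRep I x (applyEndo I A e))
      (prolong (Â (extChartAt I x x)) (fderiv ℝ Â (extChartAt I x x)) (jet I e x)).2
      (extChartAt I x x) := by
  have := h.differentiableAt.hasFDerivAt.clm_apply he.hasFDerivAt
  rw [localRep_self] at this
  refine this.congr_of_eventuallyEq ?_
  filter_upwards [h.eventually_apply] with z hz using hz _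

theorem HasEndoRepAt.diffAt (h : HasEndoRepAt I A x Â) (he : DiffAt I e x) :
    DiffAt I (applyEndo I A e) x :=
  (h.hasFDerivAt he).differentiableAt

theorem HasEndoRepAt.jet_applyEndo (h : HasEndoRepAt I A x Â) (he : DiffAt I e x) :
    jet I (applyEndo I A e) x
      = prolong (Â (extChartAt I x x)) (fderiv ℝ Â (extChartAt I x x)) (jet I e x) :=
  Prod.ext (h.apply_self (e x)).symm (h.hasFDerivAt he).fderiv

theorem HasEndoRepAt.torsion_eq [I.Boundaryless] (h : HasEndoRepAt I A x Â) (h₁ : DiffAt I e₁ x)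
    (h₂ : DiffAt I e₂ x) :
    torsion I A e₁ e₂ x =
      jetTorsion (ContinuousLinearMap.fst ℝ E _) (ContinuousLinearMap.inr ℝ E _) (modelFlat E)
        (Â (extChartAt I x x)) (fderiv ℝ Â (extChartAt I x x)) (jet I e₁ x) (jet I e₂ x) := by
  rw [torsion, courant_eq_modelBracket (h.diffAt h₁) (h.diffAt h₂),
    courant_eq_modelBracket (h.diffAt h₁) h₂, courant_eq_modelBracket h₁ (h.diffAt h₂),
    courant_eq_modelBracket h₁ h₂, h.jet_applyEndo h₁, h.jet_applyEndo h₂, ← h.apply_self]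
  rfl

theorem IsSmoothEndo.isSmoothSection (hA : IsSmoothEndo I A) (he : IsSmoothSection I e) :
    IsSmoothSection I (applyEndo I A e) :=
  fun x => ContMDiffAt.clm_bundle_apply (hA x) (he x)

theorem continuousLinearMapAt_eq_readFibre {x₀ y : M} (hy : y ∈ (chartAt H x₀).source)
    (v : BigTangent I y) :
    (trivializationAt (ModelFibre E) (fun y : M => BigTangent I y) x₀).continuousLinearMapAt ℝ y v
      = readFibre I x₀ y v := by
  have hb : y ∈ (trivializationAt (ModelFibre E) (fun y : M => BigTangent I y) x₀).baseSet :=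
    ⟨hy, hy, mem_univ _⟩
  rw [Bundle.Trivialization.continuousLinearMapAt_apply,
    Bundle.Trivialization.coe_linearMapAt_of_mem _ hb]
  exact trivializationAt_eq_readFibre I hy v

set_option synthInstance.maxHeartbeats 400000 in -- nested spaces of continuous linear maps
theorem IsSmoothEndo.hasEndoRepAt [I.Boundaryless] (hA : IsSmoothEndo I A) (x : M) :
    ∃ Â, HasEndoRepAt I A x Â := by
  have h := (contMDiffAt_hom_bundle _).1 (hA x)
  refine ⟨_, differentiableAt_comp_extChartAt_symm h.2, ?_⟩
  filter_upwards [eventually_extChartAt_symm_mem_source x] with z hz v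
  have hb : (extChartAt I x).symm z
      ∈ (trivializationAt (ModelFibre E) (fun y : M => BigTangent I y) x).baseSet :=
    ⟨hz, hz, mem_univ _⟩
  rw [← continuousLinearMapAt_eq_readFibre hz, ← continuousLinearMapAt_eq_readFibre hz]
  simp only [Function.comp_apply, ContinuousLinearMap.inCoordinates,
    ContinuousLinearMap.comp_apply]
  rw [Bundle.Trivialization.symmL_continuousLinearMapAt _ hb]

theorem involution_torsion {V : Type*} [AddCommGroup V] [Module ℝ V] [TopologicalSpace V]
    (J : V →L[ℝ] V) (hsq : ∀ a, J (J a) = a) (b₁₁ b₁₀ b₀₁ b₀₀ : V) :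
    b₀₁ - J (b₀₀ + b₁₁) + b₁₀ = -J (b₁₁ - J (b₁₀ + b₀₁) + b₀₀) := by
  simp only [map_add, map_sub, hsq]
  abel

omit [IsManifold I ∞ M] in
theorem torsion_applyEndo_left {J : ∀ x : M, BigTangent I x →L[ℝ] BigTangent I x}
    (hsq : ∀ x a, J x (J x a) = a) (e₁ e₂ : ∀ x : M, BigTangent I x) (x : M) :
    torsion I J (applyEndo I J e₁) e₂ x = -J x (torsion I J e₁ e₂ x) := by
  have h : applyEndo I J (applyEndo I J e₁) = e₁ := funext fun y => hsq y _
  rw [torsion, torsion, h]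
  exact involution_torsion (J x) (hsq x) _ _ _ _

theorem exists_torsionTensor [I.Boundaryless]
    (hsq : ∀ x a, A x (A x a) = a)
    (hskew : ∀ a b : BigTangent I x, metric I (A x a) b + metric I a (A x b) = 0)
    (hA : HasEndoRepAt I A x Â) :
    ∃ T : BigTangent I x →ₗ[ℝ] BigTangent I x →ₗ[ℝ] BigTangent I x,
      (∀ e₁ e₂, DiffAt I e₁ x → DiffAt I e₂ x → torsion I A e₁ e₂ x = T (e₁ x) (e₂ x)) ∧
      (∀ a b, T a b = -T b a) ∧ ∀ a b, T (A x a) b = -A x (T a b) := by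
  have hÂsq (a : ModelFibre E) : Â (extChartAt I x x) (Â (extChartAt I x x) a) = a :=
    ((congrArg _ (hA.apply_self a)).trans (hA.apply_self _)).trans (hsq x a)
  have hÂskew (a b : ModelFibre E) : modelFlat E (Â (extChartAt I x x) a) b
      = -modelFlat E a (Â (extChartAt I x x) b) := by
    have h₁ : modelFlat E (Â (extChartAt I x x) a) b = metric I (A x a) b :=
      congrArg (fun c : ModelFibre E => modelFlat E c b) (hA.apply_self a)
    have h₂ : modelFlat E a (Â (extChartAt I x x) b) = metric I a (A x b) :=
      congrArg (fun c : ModelFibre E => modelFlat E a c) (hA.apply_self b)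
    rw [h₁, h₂]
    exact eq_neg_of_add_eq_zero_left (hskew a b)
  let T : BigTangent I x →ₗ[ℝ] BigTangent I x →ₗ[ℝ] BigTangent I x :=
    torsionForm (V := ModelFibre E) (ContinuousLinearMap.fst ℝ E _)
      (ContinuousLinearMap.inr ℝ E _) (modelFlat E) (Â (extChartAt I x x))
      (fderiv ℝ Â (extChartAt I x x))
  have torsion_eq_T (e₁ e₂ : ∀ x : M, BigTangent I x) (h₁ : DiffAt I e₁ x) (h₂ : DiffAt I e₂ x) :
      torsion I A e₁ e₂ x = T (e₁ x) (e₂ x) :=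
    (hA.torsion_eq h₁ h₂).trans (jetTorsion_eq_torsionForm (V := ModelFibre E)
      (fderiv ℝ Â (extChartAt I x x)) hÂskew hÂsq (jet I e₁ x) (jet I e₂ x))
  refine ⟨T, torsion_eq_T, torsionForm_swap (V := ModelFibre E) _, fun a b => ?_⟩
  obtain ⟨e₁, h₁, rfl⟩ := exists_diffAt x a
  obtain ⟨e₂, h₂, rfl⟩ := exists_diffAt x b
  rw [← torsion_eq_T e₁ e₂ h₁ h₂, ← torsion_applyEndo_left hsq]
  exact (torsion_eq_T _ _ (hA.diffAt h₁) h₂).symm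

end Endomorphisms

section ProductFibre

variable {E : Type*} [NormedAddCommGroup E] [NormedSpace ℝ E]
  {H : Type*} [TopologicalSpace H] {I : ModelWithCorners ℝ E H}
  {M : Type*} [TopologicalSpace M] [ChartedSpace H M]

/-- The section `c ∂_t + d dt` of the big tangent bundle of `M × ℝ`. -/
def constBig (I : ModelWithCorners ℝ E H) (c d : ℝ) (p : M × ℝ) :
    BigTangent (I.prod 𝓘(ℝ, ℝ)) p :=
  ((0, c), d • ContinuousLinearMap.snd ℝ E ℝ)

theorem constBig_eq (c d : ℝ) (p : M × ℝ) :
    constBig I c d p = c • bigDdt I p + d • bigDt I p := by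
  have h : (((0, c), d • ContinuousLinearMap.snd ℝ E ℝ) : ModelFibre (E × ℝ))
      = c • ((0, 1), 0) + d • (0, ContinuousLinearMap.snd ℝ E ℝ) := by simp
  exact h

theorem projBig_inclBig (p : M × ℝ) (a : BigTangent I p.1) : projBig I p (inclBig I p a) = a := rfl

theorem coeffDdt_inclBig (p : M × ℝ) (a : BigTangent I p.1) : coeffDdt I p (inclBig I p a) = 0 :=
  rfl

theorem coeffDt_inclBig (p : M × ℝ) (a : BigTangent I p.1) : coeffDt I p (inclBig I p a) = 0 :=
  map_zero a.2

theorem projBig_constBig (c d : ℝ) (p : M × ℝ) : projBig I p (constBig I c d p) = 0 :=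
  Prod.ext rfl (ContinuousLinearMap.ext fun _ => mul_zero d)

theorem coeffDdt_constBig (c d : ℝ) (p : M × ℝ) : coeffDdt I p (constBig I c d p) = c := rfl

theorem coeffDt_constBig (c d : ℝ) (p : M × ℝ) : coeffDt I p (constBig I c d p) = d := mul_one d

theorem snd_fst_eq_add (p : M × ℝ) (v w : BigTangent (I.prod 𝓘(ℝ, ℝ)) p) :
    v.2 w.1 = (projBig I p v).2 (projBig I p w).1 + coeffDt I p v * coeffDdt I p w := by
  have h (α : E × ℝ →L[ℝ] ℝ) (X : E × ℝ) : α X = α (X.1, 0) + α (0, 1) * X.2 := by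
    have : X = (X.1, 0) + X.2 • ((0, 1) : E × ℝ) := by ext <;> simp
    conv_lhs => rw [this, map_add, map_smul, smul_eq_mul, mul_comm]
  exact h v.2 w.1

theorem inclBig_projBig_add_constBig (p : M × ℝ) (v : BigTangent (I.prod 𝓘(ℝ, ℝ)) p) :
    inclBig I p (projBig I p v) + constBig I (coeffDdt I p v) (coeffDt I p v) p = v :=
  Prod.ext (Prod.ext (add_zero v.1.1) (zero_add v.1.2))
    (ContinuousLinearMap.ext fun w => (snd_fst_eq_add p v (w, 0)).symm)

theorem bigTangent_prod_ext {p : M × ℝ} {v w : BigTangent (I.prod 𝓘(ℝ, ℝ)) p}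
    (hproj : projBig I p v = projBig I p w) (hddt : coeffDdt I p v = coeffDdt I p w)
    (hdt : coeffDt I p v = coeffDt I p w) : v = w := by
  rw [← inclBig_projBig_add_constBig p v, hproj, hddt, hdt, inclBig_projBig_add_constBig]

theorem metric_prod (p : M × ℝ) (v w : BigTangent (I.prod 𝓘(ℝ, ℝ)) p) :
    metric (I.prod 𝓘(ℝ, ℝ)) v w = metric I (projBig I p v) (projBig I p w)
      + 1 / 2 * (coeffDt I p v * coeffDdt I p w + coeffDt I p w * coeffDdt I p v) := by
  rw [metric, metric, snd_fst_eq_add p v w, snd_fst_eq_add p w v]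
  ring

variable (F : ∀ x : M, BigTangent I x →L[ℝ] BigTangent I x) (Z : ∀ x : M, TangentSpace I x)
  (ξ : ∀ x : M, CotangentSpace I x)

theorem productEndo_apply (p : M × ℝ) (v : BigTangent (I.prod 𝓘(ℝ, ℝ)) p) :
    productEndo I F Z ξ p v
      = inclBig I p (F p.1 (projBig I p v) + coeffDt I p v • (Z p.1, 0)
          - coeffDdt I p v • (0, ξ p.1))
        + constBig I (-(projBig I p v).2 (Z p.1)) (ξ p.1 (projBig I p v).1) p := by
  rw [constBig_eq, neg_smul ((projBig I p v).2 (Z p.1)) (bigDdt I p), map_sub, map_add, map_smul,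
    map_smul, ← add_assoc, ← sub_eq_add_neg]
  rfl

theorem projBig_productEndo (p : M × ℝ) (v : BigTangent (I.prod 𝓘(ℝ, ℝ)) p) :
    projBig I p (productEndo I F Z ξ p v) = F p.1 (projBig I p v)
      + coeffDt I p v • (Z p.1, 0) - coeffDdt I p v • (0, ξ p.1) := by
  rw [productEndo_apply, map_add, projBig_inclBig, projBig_constBig, add_zero]

theorem coeffDdt_productEndo (p : M × ℝ) (v : BigTangent (I.prod 𝓘(ℝ, ℝ)) p) :
    coeffDdt I p (productEndo I F Z ξ p v) = -(projBig I p v).2 (Z p.1) := by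
  rw [productEndo_apply, map_add, coeffDdt_inclBig, coeffDdt_constBig, zero_add]

theorem coeffDt_productEndo (p : M × ℝ) (v : BigTangent (I.prod 𝓘(ℝ, ℝ)) p) :
    coeffDt I p (productEndo I F Z ξ p v) = ξ p.1 (projBig I p v).1 := by
  rw [productEndo_apply, map_add, coeffDt_inclBig, coeffDt_constBig, zero_add]

theorem productEndo_inclBig (p : M × ℝ) (a : BigTangent I p.1) :
    productEndo I F Z ξ p (inclBig I p a)
      = inclBig I p (F p.1 a) + constBig I (-a.2 (Z p.1)) (ξ p.1 a.1) p := by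
  rw [productEndo_apply, projBig_inclBig, coeffDt_inclBig, coeffDdt_inclBig, zero_smul, zero_smul,
    add_zero, sub_zero]

theorem productEndo_constBig (c d : ℝ) (p : M × ℝ) :
    productEndo I F Z ξ p (constBig I c d p) = inclBig I p (d • (Z p.1, 0) - c • (0, ξ p.1)) := by
  refine bigTangent_prod_ext ?_ ?_ ?_
  · rw [projBig_productEndo, projBig_constBig, coeffDt_constBig, coeffDdt_constBig,
      ContinuousLinearMap.map_zero, zero_add, projBig_inclBig]
  · rw [coeffDdt_productEndo, projBig_constBig, coeffDdt_inclBig]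
    exact neg_zero
  · rw [coeffDt_productEndo, projBig_constBig, coeffDt_inclBig]
    exact map_zero (ξ p.1)

end ProductFibre

section ProductModel

variable {E : Type*} [NormedAddCommGroup E] [NormedSpace ℝ E]

/-- The inclusion `(X, α) ↦ (X + 0 ∂_t, α + 0 dt)` over a normed space. -/
def modelIncl (E : Type*) [NormedAddCommGroup E] [NormedSpace ℝ E] :
    ModelFibre E →L[ℝ] ModelFibre (E × ℝ) :=
  inclBig 𝓘(ℝ, E) (0 : E × ℝ)

/-- The projection `(X + f ∂_t, α + g dt) ↦ (X, α)` over a normed space. -/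
def modelProj (E : Type*) [NormedAddCommGroup E] [NormedSpace ℝ E] :
    ModelFibre (E × ℝ) →L[ℝ] ModelFibre E :=
  projBig 𝓘(ℝ, E) (0 : E × ℝ)

/-- The element `c ∂_t + d dt` of the fibre over a normed space. -/
def modelConst (E : Type*) [NormedAddCommGroup E] [NormedSpace ℝ E] (c d : ℝ) :
    ModelFibre (E × ℝ) :=
  constBig 𝓘(ℝ, E) c d (0 : E × ℝ)

/-- The endomorphism `productEndo` over a normed space, for an endomorphism `A` of the fibre in the
place of `F` and an element `b` of the fibre in the place of `(Z, ξ)`. -/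
def modelProductEndo (A : ModelFibre E →L[ℝ] ModelFibre E) (b : ModelFibre E) :
    ModelFibre (E × ℝ) →L[ℝ] ModelFibre (E × ℝ) :=
  productEndo 𝓘(ℝ, E) (fun _ => A) (fun _ => b.1) (fun _ => b.2) (0 : E × ℝ)

theorem modelProductEndo_apply (A : ModelFibre E →L[ℝ] ModelFibre E) (b : ModelFibre E)
    (v : ModelFibre (E × ℝ)) :
    modelProductEndo A b v
      = modelIncl E (A (modelProj E v) + v.2 (0, 1) • (b.1, 0) - v.1.2 • (0, b.2))
        + modelConst E (-(modelProj E v).2 b.1) (b.2 (modelProj E v).1) :=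
  productEndo_apply (I := 𝓘(ℝ, E)) (fun _ => A) (fun _ => b.1) (fun _ => b.2) (0 : E × ℝ) v

theorem differentiableAt_smulRight {X U W : Type*} [NormedAddCommGroup X] [NormedSpace ℝ X]
    [NormedAddCommGroup U] [NormedSpace ℝ U] [NormedAddCommGroup W] [NormedSpace ℝ W]
    {c : X → U →L[ℝ] ℝ} {f : X → W} {x : X} (hc : DifferentiableAt ℝ c x)
    (hf : DifferentiableAt ℝ f x) : DifferentiableAt ℝ (fun y => (c y).smulRight (f y)) x :=
  DifferentiableAt.comp (g := fun q : (U →L[ℝ] ℝ) × W => q.1.smulRight q.2) x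
    (isBoundedBilinearMap_smulRight.differentiableAt (c x, f x)) (hc.prodMk hf)

theorem differentiableAt_comp_fst {W : Type*} [NormedAddCommGroup W] [NormedSpace ℝ W]
    {f : E → W} {z : E × ℝ} (hf : DifferentiableAt ℝ f z.1) :
    DifferentiableAt ℝ (fun y : E × ℝ => f y.1) z :=
  hf.comp z differentiableAt_fst

set_option synthInstance.maxHeartbeats 400000 in -- nested spaces of continuous linear maps
theorem differentiableAt_modelProductEndo {A : E → ModelFibre E →L[ℝ] ModelFibre E}
    {b : E → ModelFibre E} {z : E × ℝ} (hA : DifferentiableAt ℝ A z.1)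
    (hb : DifferentiableAt ℝ b z.1) :
    DifferentiableAt ℝ (fun y : E × ℝ => modelProductEndo (A y.1) (b y.1)) z := by
  replace hA := differentiableAt_comp_fst (W := ModelFibre E →L[ℝ] ModelFibre E) hA
  replace hb := differentiableAt_comp_fst hb
  let ddtElem : ModelFibre (E × ℝ) := bigDdt 𝓘(ℝ, E) (0 : E × ℝ)
  let dtElem : ModelFibre (E × ℝ) := bigDt 𝓘(ℝ, E) (0 : E × ℝ)
  have endo := ((differentiableAt_const (modelIncl E)).clm_comp
    (hA.clm_comp (differentiableAt_const (modelProj E))))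
  have vector := differentiableAt_smulRight
    (differentiableAt_const ((ContinuousLinearMap.apply ℝ ℝ ((0, 1) : E × ℝ)).comp
        (ContinuousLinearMap.snd ℝ (E × ℝ) _)))
    ((modelIncl E).differentiableAt.comp z
      (hb.fst.prodMk (differentiableAt_const (0 : E →L[ℝ] ℝ))))
  have form := differentiableAt_smulRight
    (differentiableAt_const ((ContinuousLinearMap.snd ℝ E ℝ).comp
        (ContinuousLinearMap.fst ℝ (E × ℝ) ((E × ℝ) →L[ℝ] ℝ))))
    ((modelIncl E).differentiableAt.comp z ((differentiableAt_const (0 : E)).prodMk hb.snd))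
  have ddt := differentiableAt_smulRight
    (((ContinuousLinearMap.apply ℝ ℝ : E →L[ℝ] (E →L[ℝ] ℝ) →L[ℝ] ℝ).differentiableAt.comp z
      hb.fst).clm_comp (differentiableAt_const
        ((ContinuousLinearMap.snd ℝ E (E →L[ℝ] ℝ)).comp (modelProj E))))
    (differentiableAt_const ddtElem)
  have dt := differentiableAt_smulRight
    (hb.snd.clm_comp (differentiableAt_const
      ((ContinuousLinearMap.fst ℝ E (E →L[ℝ] ℝ)).comp (modelProj E))))
    (differentiableAt_const dtElem)
  exact (((endo.add vector).sub form).sub ddt).add dt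

/-- The 1-jet of the translation-invariant section over `E × ℝ` that a section over `E` defines. -/
def pullJet (a : Jet E (ModelFibre E)) : Jet (E × ℝ) (ModelFibre (E × ℝ)) :=
  (modelIncl E a.1, (modelIncl E).comp (a.2.comp (ContinuousLinearMap.fst ℝ E ℝ)))

theorem modelBracket_pullJet (a b : Jet E (ModelFibre E)) :
    modelBracket (pullJet a) (pullJet b) = modelIncl E (modelBracket a b) := by
  simp only [modelBracket, jetBracket, LinearMap.mk₂_apply, map_add, map_sub]
  rfl

theorem modelBracket_pullJet_modelConst (a : Jet E (ModelFibre E)) (c d : ℝ) :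
    modelBracket (pullJet a) (modelConst E c d, 0) = 0 := by
  have flat_comp : (modelFlat (E × ℝ) (modelConst E c d)).comp (pullJet a).2 = 0 := by
    refine ContinuousLinearMap.ext fun v => ?_
    change 1 / 2 * (d * (0 : ℝ) + (a.2 v.1).2 0) = 0
    rw [map_zero, mul_zero, add_zero, mul_zero]
  have deriv_const : (pullJet a).2 (modelConst E c d).1 = 0 := by
    simp [pullJet, modelConst, constBig]
  simp only [modelBracket, jetBracket, LinearMap.mk₂_apply, flat_comp]
  simp [deriv_const]

end ProductModel

section ProductManifold

variable {E : Type*} [NormedAddCommGroup E] [NormedSpace ℝ E]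
  {H : Type*} [TopologicalSpace H] (I : ModelWithCorners ℝ E H)
  {M : Type*} [TopologicalSpace M] [ChartedSpace H M] [IsManifold I ∞ M]
  [I.Boundaryless]

theorem tangentCoordChange_prod {p q r : M × ℝ} (hp : r.1 ∈ (chartAt H p.1).source)
    (hq : r.1 ∈ (chartAt H q.1).source) :
    tangentCoordChange (I.prod 𝓘(ℝ, ℝ)) p q r
      = (tangentCoordChange I p.1 q.1 r.1).prodMap (ContinuousLinearMap.id ℝ ℝ) := by
  have product : HasFDerivWithinAt _ _ _ _ :=
    hasFDerivWithinAt_tangentCoordChange (I := I.prod 𝓘(ℝ, ℝ)) (x := p) (y := q) (z := r)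
      (by simpa [hp, hq] using ⟨mem_univ _, mem_univ _⟩)
  have factor := hasFDerivWithinAt_tangentCoordChange (I := I) (x := p.1) (y := q.1) (z := r.1)
    (by simp [hp, hq])
  rw [ModelWithCorners.range_eq_univ, hasFDerivWithinAt_univ] at product factor
  exact product.unique (HasFDerivAt.prodMap (extChartAt (I.prod 𝓘(ℝ, ℝ)) p r) factor
    (hasFDerivAt_id (𝕜 := ℝ) r.2))

theorem continuousLinearMapAt_prod {p q : M × ℝ} (hq : q.1 ∈ (chartAt H p.1).source) :
    (trivializationAt (E × ℝ) (TangentSpace (I.prod 𝓘(ℝ, ℝ))) p).continuousLinearMapAt ℝ q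
      = ((trivializationAt E (TangentSpace I) p.1).continuousLinearMapAt ℝ q.1 : E →L[ℝ] E).prodMap
        (ContinuousLinearMap.id ℝ ℝ) := by
  have hq' : q ∈ (chartAt (ModelProd H ℝ) p).source := ⟨hq, mem_univ _⟩
  rw [TangentBundle.continuousLinearMapAt_trivializationAt_eq_core hq',
    TangentBundle.continuousLinearMapAt_trivializationAt_eq_core hq]
  exact tangentCoordChange_prod I (mem_chart_source H q.1) hq

theorem symmL_prod {p q : M × ℝ} (hq : q.1 ∈ (chartAt H p.1).source) :
    (trivializationAt (E × ℝ) (TangentSpace (I.prod 𝓘(ℝ, ℝ))) p).symmL ℝ q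
      = ((trivializationAt E (TangentSpace I) p.1).symmL ℝ q.1 : E →L[ℝ] E).prodMap
        (ContinuousLinearMap.id ℝ ℝ) := by
  have hq' : q ∈ (chartAt (ModelProd H ℝ) p).source := ⟨hq, mem_univ _⟩
  rw [TangentBundle.symmL_trivializationAt_eq_core hq',
    TangentBundle.symmL_trivializationAt_eq_core hq]
  exact tangentCoordChange_prod I hq (mem_chart_source H q.1)

theorem readFibre_prod {p q : M × ℝ} (hq : q.1 ∈ (chartAt H p.1).source)
    (v : BigTangent (I.prod 𝓘(ℝ, ℝ)) q) :
    readFibre (I.prod 𝓘(ℝ, ℝ)) p q v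
      = (((trivializationAt E (TangentSpace I) p.1).continuousLinearMapAt ℝ q.1 v.1.1, v.1.2),
        v.2.comp (((trivializationAt E (TangentSpace I) p.1).symmL ℝ q.1 : E →L[ℝ] E).prodMap
          (ContinuousLinearMap.id ℝ ℝ))) :=
  Prod.ext (congrArg (fun A : E × ℝ →L[ℝ] E × ℝ => A v.1) (continuousLinearMapAt_prod I hq))
    (congrArg (fun A : E × ℝ →L[ℝ] E × ℝ => v.2.comp A) (symmL_prod I hq))

theorem readFibre_inclBig {p q : M × ℝ} (hq : q.1 ∈ (chartAt H p.1).source)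
    (v : BigTangent I q.1) :
    readFibre (I.prod 𝓘(ℝ, ℝ)) p q (inclBig I q v) = modelIncl E (readFibre I p.1 q.1 v) :=
  readFibre_prod I hq _

theorem readFibre_constBig {p q : M × ℝ} (hq : q.1 ∈ (chartAt H p.1).source) (c d : ℝ) :
    readFibre (I.prod 𝓘(ℝ, ℝ)) p q (constBig I c d q) = modelConst E c d := by
  refine (readFibre_prod I hq _).trans (Prod.ext (Prod.ext ?_ rfl) rfl)
  exact map_zero ((trivializationAt E (TangentSpace I) p.1).continuousLinearMapAt ℝ q.1)

theorem modelProj_readFibre {p q : M × ℝ} (hq : q.1 ∈ (chartAt H p.1).source)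
    (v : BigTangent (I.prod 𝓘(ℝ, ℝ)) q) :
    modelProj E (readFibre (I.prod 𝓘(ℝ, ℝ)) p q v) = readFibre I p.1 q.1 (projBig I q v) :=
  congrArg (modelProj E) (readFibre_prod I hq v)

theorem readFibre_productEndo (F : ∀ x : M, BigTangent I x →L[ℝ] BigTangent I x)
    (Z : ∀ x : M, TangentSpace I x) (ξ : ∀ x : M, CotangentSpace I x) {p q : M × ℝ}
    (hq : q.1 ∈ (chartAt H p.1).source) {A : ModelFibre E →L[ℝ] ModelFibre E}
    (hA : ∀ v, readFibre I p.1 q.1 (F q.1 v) = A (readFibre I p.1 q.1 v))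
    (v : BigTangent (I.prod 𝓘(ℝ, ℝ)) q) :
    readFibre (I.prod 𝓘(ℝ, ℝ)) p q (productEndo I F Z ξ q v)
      = modelProductEndo A (readFibre I p.1 q.1 (Z q.1, ξ q.1))
        (readFibre (I.prod 𝓘(ℝ, ℝ)) p q v) := by
  have coeffDt_eq : (readFibre (I.prod 𝓘(ℝ, ℝ)) p q v).2 ((0, 1) : E × ℝ) = coeffDt I q v := by
    refine (congrArg (fun a : ModelFibre (E × ℝ) => a.2 (0, 1)) (readFibre_prod I hq v)).trans
      (congrArg v.2 (Prod.ext ?_ rfl))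
    exact map_zero ((trivializationAt E (TangentSpace I) p.1).symmL ℝ q.1)
  have coeffDdt_eq : (readFibre (I.prod 𝓘(ℝ, ℝ)) p q v).1.2 = coeffDdt I q v :=
    (congrArg (fun a : ModelFibre (E × ℝ) => a.1.2) (readFibre_prod I hq v)).trans rfl
  have vector_eq : readFibre I p.1 q.1 (Z q.1, 0)
      = (((readFibre I p.1 q.1 (Z q.1, ξ q.1)).1, 0) : ModelFibre E) := rfl
  have form_eq : readFibre I p.1 q.1 (0, ξ q.1)
      = ((0, (readFibre I p.1 q.1 (Z q.1, ξ q.1)).2) : ModelFibre E) :=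
    Prod.ext (map_zero ((trivializationAt E (TangentSpace I) p.1).continuousLinearMapAt ℝ q.1)) rfl
  rw [modelProductEndo_apply, modelProj_readFibre I hq, coeffDt_eq, coeffDdt_eq, ← vector_eq,
    ← form_eq, readFibre_pairing I hq, readFibre_pairing I hq, ← hA, productEndo_apply, map_add,
    readFibre_inclBig I hq, readFibre_constBig I hq, map_sub, map_add, map_smul, map_smul]

variable {I}

set_option synthInstance.maxHeartbeats 400000 in -- nested spaces of continuous linear maps
theorem HasEndoRepAt.productEndo {F : ∀ x : M, BigTangent I x →L[ℝ] BigTangent I x}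
    {Z : ∀ x : M, TangentSpace I x} {ξ : ∀ x : M, CotangentSpace I x} {p : M × ℝ}
    {Â : E → ModelFibre E →L[ℝ] ModelFibre E} (hF : HasEndoRepAt I F p.1 Â)
    (hZξ : DiffAt I (fun x => (Z x, ξ x)) p.1) :
    HasEndoRepAt (I.prod 𝓘(ℝ, ℝ)) (productEndo I F Z ξ) p
      fun z : E × ℝ => modelProductEndo (Â z.1) (localRep I p.1 (fun x => (Z x, ξ x)) z.1) := by
  refine ⟨?_, ?_⟩
  · exact differentiableAt_modelProductEndo (z := extChartAt (I.prod 𝓘(ℝ, ℝ)) p p)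
      hF.differentiableAt hZξ
  · have fst_tendsto : Tendsto Prod.fst (𝓝 (extChartAt (I.prod 𝓘(ℝ, ℝ)) p p))
        (𝓝 (extChartAt I p.1 p.1)) :=
      (continuous_fst (X := E) (Y := ℝ)).tendsto _
    filter_upwards [fst_tendsto.eventually hF.eventually_apply,
      fst_tendsto.eventually (eventually_extChartAt_symm_mem_source p.1)] with z hA hz v
    exact readFibre_productEndo I F Z ξ (q := (extChartAt (I.prod 𝓘(ℝ, ℝ)) p).symm z) hz hA v

end ProductManifold

section InvariantSections

variable {E : Type*} [NormedAddCommGroup E] [NormedSpace ℝ E]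
  {H : Type*} [TopologicalSpace H] {I : ModelWithCorners ℝ E H}
  {M : Type*} [TopologicalSpace M] [ChartedSpace H M]

/-- The translation-invariant section of the big tangent bundle of `M × ℝ` defined by a section
over `M`. -/
def pullBig (I : ModelWithCorners ℝ E H) (e : ∀ x : M, BigTangent I x) (p : M × ℝ) :
    BigTangent (I.prod 𝓘(ℝ, ℝ)) p :=
  inclBig I p (e p.1)

variable [IsManifold I ∞ M] [I.Boundaryless] {e e₁ e₂ : ∀ x : M, BigTangent I x} {p : M × ℝ}

theorem localRep_pullBig (e : ∀ x : M, BigTangent I x) (p : M × ℝ) :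
    localRep (I.prod 𝓘(ℝ, ℝ)) p (pullBig I e)
      =ᶠ[𝓝 (extChartAt (I.prod 𝓘(ℝ, ℝ)) p p)] fun z : E × ℝ =>
        modelIncl E (localRep I p.1 e z.1) := by
  have fst_tendsto : Tendsto Prod.fst (𝓝 (extChartAt (I.prod 𝓘(ℝ, ℝ)) p p))
      (𝓝 (extChartAt I p.1 p.1)) :=
    (continuous_fst (X := E) (Y := ℝ)).tendsto _
  filter_upwards [fst_tendsto.eventually (eventually_extChartAt_symm_mem_source p.1)] with z hz
  exact readFibre_inclBig I (q := (extChartAt (I.prod 𝓘(ℝ, ℝ)) p).symm z) hz _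

theorem localRep_constBig (c d : ℝ) (p : M × ℝ) :
    localRep (I.prod 𝓘(ℝ, ℝ)) p (constBig I c d)
      =ᶠ[𝓝 (extChartAt (I.prod 𝓘(ℝ, ℝ)) p p)] fun _ => modelConst E c d := by
  have fst_tendsto : Tendsto Prod.fst (𝓝 (extChartAt (I.prod 𝓘(ℝ, ℝ)) p p))
      (𝓝 (extChartAt I p.1 p.1)) :=
    (continuous_fst (X := E) (Y := ℝ)).tendsto _
  filter_upwards [fst_tendsto.eventually (eventually_extChartAt_symm_mem_source p.1)] with z hz
  exact readFibre_constBig I (q := (extChartAt (I.prod 𝓘(ℝ, ℝ)) p).symm z) hz c d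

theorem hasFDerivAt_localRep_pullBig (he : DiffAt I e p.1) :
    HasFDerivAt (localRep (I.prod 𝓘(ℝ, ℝ)) p (pullBig I e)) (pullJet (jet I e p.1)).2
      (extChartAt (I.prod 𝓘(ℝ, ℝ)) p p) :=
  HasFDerivAt.congr_of_eventuallyEq
    ((modelIncl E).hasFDerivAt.comp (extChartAt (I.prod 𝓘(ℝ, ℝ)) p p)
      (HasFDerivAt.comp (f := Prod.fst) (extChartAt (I.prod 𝓘(ℝ, ℝ)) p p) he.hasFDerivAt
        hasFDerivAt_fst))
    (localRep_pullBig e p)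

theorem DiffAt.pullBig (he : DiffAt I e p.1) : DiffAt (I.prod 𝓘(ℝ, ℝ)) (pullBig I e) p :=
  (hasFDerivAt_localRep_pullBig he).differentiableAt

theorem jet_pullBig (he : DiffAt I e p.1) :
    jet (I.prod 𝓘(ℝ, ℝ)) (GenParacontact.pullBig I e) p = pullJet (jet I e p.1) :=
  Prod.ext rfl (hasFDerivAt_localRep_pullBig he).fderiv

theorem hasFDerivAt_localRep_constBig (c d : ℝ) (p : M × ℝ) :
    HasFDerivAt (localRep (I.prod 𝓘(ℝ, ℝ)) p (constBig I c d))
      (0 : E × ℝ →L[ℝ] ModelFibre (E × ℝ)) (extChartAt (I.prod 𝓘(ℝ, ℝ)) p p) :=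
  (hasFDerivAt_const _ _).congr_of_eventuallyEq (localRep_constBig c d p)

theorem diffAt_constBig (c d : ℝ) (p : M × ℝ) : DiffAt (I.prod 𝓘(ℝ, ℝ)) (constBig I c d) p :=
  (hasFDerivAt_localRep_constBig c d p).differentiableAt

theorem jet_constBig (c d : ℝ) (p : M × ℝ) :
    jet (I.prod 𝓘(ℝ, ℝ)) (constBig I c d) p = (modelConst E c d, 0) :=
  Prod.ext rfl (hasFDerivAt_localRep_constBig c d p).fderiv

theorem courant_pullBig (h₁ : DiffAt I e₁ p.1) (h₂ : DiffAt I e₂ p.1) :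
    courant (I.prod 𝓘(ℝ, ℝ)) (pullBig I e₁) (pullBig I e₂) p
      = inclBig I p (courant I e₁ e₂ p.1) := by
  rw [courant_eq_modelBracket h₁.pullBig h₂.pullBig, jet_pullBig h₁, jet_pullBig h₂,
    courant_eq_modelBracket h₁ h₂]
  exact modelBracket_pullJet (jet I e₁ p.1) (jet I e₂ p.1)

theorem courant_pullBig_constBig (he : DiffAt I e p.1) (c d : ℝ) :
    courant (I.prod 𝓘(ℝ, ℝ)) (pullBig I e) (constBig I c d) p = 0 := by
  rw [courant_eq_modelBracket he.pullBig (diffAt_constBig c d p), jet_pullBig he, jet_constBig]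
  exact modelBracket_pullJet_modelConst (jet I e p.1) c d

theorem courant_constBig_pullBig (he : DiffAt I e p.1) (c d : ℝ) :
    courant (I.prod 𝓘(ℝ, ℝ)) (constBig I c d) (pullBig I e) p = 0 := by
  rw [courant_swap (diffAt_constBig c d p) he.pullBig, courant_pullBig_constBig he, neg_zero]

theorem courant_constBig (c d c' d' : ℝ) (p : M × ℝ) :
    courant (I.prod 𝓘(ℝ, ℝ)) (constBig I c d) (constBig I c' d') p = 0 := by
  rw [courant_eq_modelBracket (diffAt_constBig c d p) (diffAt_constBig c' d' p), jet_constBig,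
    jet_constBig]
  simp only [modelBracket, jetBracket, LinearMap.mk₂_apply, zero_apply, sub_self,
    ContinuousLinearMap.comp_zero, map_zero, add_zero]
  rfl

end InvariantSections

section AlmostParacontact

variable {E : Type*} [NormedAddCommGroup E] [NormedSpace ℝ E]
  {H : Type*} [TopologicalSpace H] {I : ModelWithCorners ℝ E H}
  {M : Type*} [TopologicalSpace M] [ChartedSpace H M]

theorem metric_comm {x : M} (a b : BigTangent I x) : metric I a b = metric I b a :=
  congrArg (fun r => 1 / 2 * r) (add_comm _ _)

theorem metric_add_vector_sub_form {x : M} (a b : BigTangent I x) (c d : ℝ) (X : TangentSpace I x)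
    (α : CotangentSpace I x) :
    metric I (a + c • (X, 0) - d • (0, α)) b = metric I a b + 1 / 2 * (c * b.2 X - d * α b.1) := by
  have expand (a b : ModelFibre E) (X : E) (α : E →L[ℝ] ℝ) :
      1 / 2 * ((a + c • (X, 0) - d • (0, α)).2 b.1 + b.2 (a + c • (X, 0) - d • (0, α)).1)
        = 1 / 2 * (a.2 b.1 + b.2 a.1) + 1 / 2 * (c * b.2 X - d * α b.1) := by
    simp
    ring
  exact expand a b X α

variable {F : ∀ x : M, BigTangent I x →L[ℝ] BigTangent I x}
  {Z : ∀ x : M, TangentSpace I x} {ξ : ∀ x : M, CotangentSpace I x} {x : M} {p : M × ℝ}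

theorem frakZ_eq_add (a : BigTangent I x) :
    frakZ I Z ξ x a = ξ x a.1 • (Z x, 0) + a.2 (Z x) • (0, ξ x) := by
  have split (c d : ℝ) (X : E) (α : E →L[ℝ] ℝ) :
      ((c • X, d • α) : ModelFibre E) = c • (X, 0) + d • (0, α) := by simp
  exact split _ _ (Z x) (ξ x)

namespace IsAlmostParacontact

variable [IsManifold I ∞ M]

theorem snd_vector_of_mem_range (h : IsAlmostParacontact I F Z ξ) {a : BigTangent I x}
    (ha : a ∈ range (F x)) : a.2 (Z x) = 0 := by
  obtain ⟨b, rfl⟩ := ha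
  have := h.skew x b (Z x, 0)
  rw [h.apply_vector] at this
  simpa [metric] using this

theorem form_fst_of_mem_range (h : IsAlmostParacontact I F Z ξ) {a : BigTangent I x}
    (ha : a ∈ range (F x)) : ξ x a.1 = 0 := by
  obtain ⟨b, rfl⟩ := ha
  have := h.skew x b (0, ξ x)
  rw [h.apply_form] at this
  simpa [metric] using this

theorem apply_apply (h : IsAlmostParacontact I F Z ξ) (a : BigTangent I x) :
    F x (F x a) = a - (ξ x a.1 • (Z x, 0) + a.2 (Z x) • (0, ξ x)) := by
  rw [← frakZ_eq_add]
  exact DFunLike.congr_fun (h.sq x) a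

theorem apply_apply_of_mem_range (h : IsAlmostParacontact I F Z ξ) {a : BigTangent I x}
    (ha : a ∈ range (F x)) : F x (F x a) = a := by
  rw [h.apply_apply, h.form_fst_of_mem_range ha, h.snd_vector_of_mem_range ha, zero_smul,
    zero_smul, add_zero, sub_zero]

theorem mem_range (h : IsAlmostParacontact I F Z ξ) {a : BigTangent I x} (hX : ξ x a.1 = 0)
    (hα : a.2 (Z x) = 0) : a ∈ range (F x) :=
  ⟨F x a, by rw [h.apply_apply, hX, hα, zero_smul, zero_smul, add_zero, sub_zero]⟩

theorem productEndo_productEndo (h : IsAlmostParacontact I F Z ξ)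
    (v : BigTangent (I.prod 𝓘(ℝ, ℝ)) p) :
    productEndo I F Z ξ p (productEndo I F Z ξ p v) = v := by
  refine bigTangent_prod_ext ?_ ?_ ?_
  · rw [projBig_productEndo, projBig_productEndo, coeffDt_productEndo, coeffDdt_productEndo,
      ContinuousLinearMap.map_sub, ContinuousLinearMap.map_add, ContinuousLinearMap.map_smul,
      ContinuousLinearMap.map_smul, h.apply_vector, h.apply_form, h.apply_apply, smul_zero,
      smul_zero]
    module
  · rw [coeffDdt_productEndo, projBig_productEndo]
    change -((F p.1 (projBig I p v)).2 (Z p.1) + coeffDt I p v * 0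
      - coeffDdt I p v * ξ p.1 (Z p.1)) = _
    rw [h.snd_vector_of_mem_range (mem_range_self _), h.pairing]
    ring
  · rw [coeffDt_productEndo, projBig_productEndo]
    change ξ p.1 ((F p.1 (projBig I p v)).1 + coeffDt I p v • Z p.1 - coeffDdt I p v • 0) = _
    rw [smul_zero, sub_zero, map_add, map_smul, h.form_fst_of_mem_range (mem_range_self _),
      h.pairing]
    simp

theorem productEndo_skew (h : IsAlmostParacontact I F Z ξ)
    (v w : BigTangent (I.prod 𝓘(ℝ, ℝ)) p) :
    metric (I.prod 𝓘(ℝ, ℝ)) (productEndo I F Z ξ p v) w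
      + metric (I.prod 𝓘(ℝ, ℝ)) v (productEndo I F Z ξ p w) = 0 := by
  have skew := h.skew p.1 (projBig I p v) (projBig I p w)
  rw [metric_prod, metric_prod, projBig_productEndo, projBig_productEndo, coeffDt_productEndo,
    coeffDt_productEndo, coeffDdt_productEndo, coeffDdt_productEndo,
    metric_comm (projBig I p v) (_ - _), metric_add_vector_sub_form, metric_add_vector_sub_form,
    metric_comm (F p.1 (projBig I p w))]
  linear_combination skew

end IsAlmostParacontact

end AlmostParacontact

section CartanCalculus

variable {E : Type*} [NormedAddCommGroup E] [NormedSpace ℝ E]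
  {H : Type*} [TopologicalSpace H] {I : ModelWithCorners ℝ E H}
  {M : Type*} [TopologicalSpace M] [ChartedSpace H M]
  {e e₁ e₂ : ∀ x : M, BigTangent I x} {Z : ∀ x : M, TangentSpace I x}
  {ξ : ∀ x : M, CotangentSpace I x} {x : M}

theorem differential_const {f : M → ℝ} {c : ℝ} (hf : ∀ y, f y = c) (x : M) :
    differential I f x = 0 := by
  rw [funext hf]
  exact mfderiv_const

theorem lieForm_zero_right (X : ∀ x : M, TangentSpace I x) (x : M) :
    lieForm I X (fun _ => 0) x = 0 := by
  have chart_zero : oneFormInChart I (fun y : M => (0 : CotangentSpace I y)) x = 0 := rfl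
  have extD_zero : extD I (fun y : M => (0 : CotangentSpace I y)) x (X x) = 0 := by
    rw [extD, chart_zero, fderivWithin_zero]
    exact ContinuousLinearMap.ext fun _ => sub_zero (0 : ℝ)
  rw [lieForm, extD_zero, differential_const (f := fun y => (0 : CotangentSpace I y) (X y)) (c := 0)
    (fun _ => rfl), add_zero]

theorem lieForm_zero_left (α : ∀ x : M, CotangentSpace I x) (x : M) :
    lieForm I (fun _ => 0) α x = 0 := by
  have alternating_zero (D : E →L[ℝ] E →L[ℝ] ℝ) (φ : E →L[ℝ] E) :
      (D (φ 0) - D.flip (φ 0)).comp φ = 0 := by simp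
  have extD_zero : extD I α x 0 = 0 := alternating_zero _ _
  rw [lieForm, extD_zero, differential_const (f := fun y => α y 0) (c := 0)
    (fun y => (α y).map_zero), add_zero]

theorem courant_vector_eq_lieBig {c : ℝ} (he : ∀ y, (e y).2 (Z y) = c) (x : M) :
    courant I (fun y => (Z y, 0)) e x = lieBig I Z e x := by
  refine Prod.ext rfl ?_
  have pairing_const :
      differential I (fun y => (e y).2 (Z y) - (0 : CotangentSpace I y) (e y).1) x = 0 :=
    differential_const (fun y => (sub_zero _).trans (he y)) x
  change lieForm I Z (fun y => (e y).2) x - lieForm I (fun y => (e y).1) (fun _ => 0) x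
    - (1 / 2 : ℝ) • differential I (fun y => (e y).2 (Z y) - (0 : CotangentSpace I y) (e y).1) x = _
  rw [pairing_const, lieForm_zero_right, smul_zero, sub_zero, sub_zero]
  rfl

theorem courant_form_eq_lieForm {c : ℝ} (he : ∀ y, ξ y (e y).1 = c) (x : M) :
    courant I e (fun y => (0, ξ y)) x = (0, lieForm I (fun y => (e y).1) ξ x) := by
  refine Prod.ext (congrFun VectorField.mlieBracket_zero_right x) ?_
  have pairing_const : differential I (fun y => ξ y (e y).1 - (e y).2 0) x = 0 :=
    differential_const (fun y => by rw [map_zero, sub_zero, he]) x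
  change lieForm I (fun y => (e y).1) ξ x - lieForm I (fun _ => 0) (fun y => (e y).2) x
    - (1 / 2 : ℝ) • differential I (fun y => ξ y (e y).1 - (e y).2 0) x = _
  rw [pairing_const, lieForm_zero_left, smul_zero, sub_zero, sub_zero]

variable [IsManifold I ∞ M]

theorem DiffAt.vectorPart (he : DiffAt I e x) : DiffAt I (fun y => ((e y).1, 0)) x := by
  have rep : localRep I x (fun y => ((e y).1, 0)) = fun z => ((localRep I x e z).1, 0) :=
    funext fun z => Prod.ext rfl (ContinuousLinearMap.ext fun _ => rfl)
  rw [DiffAt, rep]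
  exact he.fst.differentiableAt.prodMk (differentiableAt_const 0)

theorem DiffAt.formPart (he : DiffAt I e x) : DiffAt I (fun y => (0, (e y).2)) x := by
  have rep : localRep I x (fun y => (0, (e y).2)) = fun z => (0, (localRep I x e z).2) :=
    funext fun z => Prod.ext ((trivializationAt E (TangentSpace I) x).continuousLinearMapAt ℝ
      ((extChartAt I x).symm z)).map_zero rfl
  rw [DiffAt, rep]
  exact (differentiableAt_const 0).prodMk he.snd.differentiableAt

variable [I.Boundaryless]

theorem extD_self (he : DiffAt I e x) (v : TangentSpace I x) :
    extD I (fun y => (e y).2) x v v = 0 :=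
  (extD_eq_jet he v v).trans (sub_self _)

theorem extD_eq_differential_sub_mlieBracket (he : DiffAt I e x) (h₁ : DiffAt I e₁ x)
    (h₂ : DiffAt I e₂ x) :
    extD I (fun y => (e y).2) x (e₁ x).1 (e₂ x).1
      = differential I (fun y => (e y).2 (e₂ y).1) x (e₁ x).1
        - differential I (fun y => (e y).2 (e₁ y).1) x (e₂ x).1
        - (e x).2 (VectorField.mlieBracket I (fun y => (e₁ y).1) (fun y => (e₂ y).1) x) := by
  rw [mlieBracket_eq_jet h₁ h₂]
  refine (extD_eq_jet he _ _).trans (Eq.symm ?_)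
  refine (congrArg₂ (· - ·) (congrArg₂ (· - ·) (differential_pairing h₂ he _)
    (differential_pairing h₁ he _)) ((e x).2.map_sub _ _)).trans ?_
  abel

end CartanCalculus

section Integrability

variable {E : Type*} [NormedAddCommGroup E] [NormedSpace ℝ E]
  {H : Type*} [TopologicalSpace H] {I : ModelWithCorners ℝ E H}
  {M : Type*} [TopologicalSpace M] [ChartedSpace H M]
  {F : ∀ x : M, BigTangent I x →L[ℝ] BigTangent I x} {Z : ∀ x : M, TangentSpace I x}
  {ξ : ∀ x : M, CotangentSpace I x}

theorem applyEndo_constBig_ddt :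
    applyEndo (I.prod 𝓘(ℝ, ℝ)) (productEndo I F Z ξ) (constBig I (-1) 0)
      = pullBig I (fun y => (0, ξ y)) := by
  funext p
  rw [applyEndo, productEndo_constBig, zero_smul, neg_smul (1 : ℝ) ((0, ξ p.1) : BigTangent I p.1),
    one_smul, zero_sub, neg_neg]
  rfl

theorem applyEndo_constBig_dt :
    applyEndo (I.prod 𝓘(ℝ, ℝ)) (productEndo I F Z ξ) (constBig I 0 1)
      = pullBig I (fun y => (Z y, 0)) := by
  funext p
  rw [applyEndo, productEndo_constBig, zero_smul, one_smul, sub_zero]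
  rfl

theorem inclBig_eq_productEndo_inclBig_iff {p : M × ℝ} {a b : BigTangent I p.1} :
    inclBig I p a = productEndo I F Z ξ p (inclBig I p b) ↔
      a = F p.1 b ∧ b.2 (Z p.1) = 0 ∧ ξ p.1 b.1 = 0 := by
  rw [productEndo_inclBig]
  constructor
  · intro h
    have vector := congrArg (coeffDdt I p) h
    have form := congrArg (coeffDt I p) h
    have base := congrArg (projBig I p) h
    rw [map_add, projBig_inclBig, projBig_inclBig, projBig_constBig, add_zero] at base
    rw [map_add, coeffDdt_inclBig, coeffDdt_inclBig, coeffDdt_constBig, zero_add] at vector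
    rw [map_add, coeffDt_inclBig, coeffDt_inclBig, coeffDt_constBig, zero_add] at form
    exact ⟨base, neg_eq_zero.1 vector.symm, form.symm⟩
  · rintro ⟨rfl, vector, form⟩
    rw [vector, form, constBig_eq, neg_zero, zero_smul, zero_smul, add_zero, add_zero]

variable [IsManifold I ∞ M]

variable (I F) in
/-- The identity `⟦F e₁, F e₂⟧ + ⟦e₁, e₂⟧ = F (⟦F e₁, e₂⟧ + ⟦e₁, F e₂⟧)` for sections of `im F`,
where `F² = I`: the part of integrability that involves `F` alone. -/
def IsIntegrableOnImage : Prop :=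
  ∀ e₁ e₂, IsSectionOfImage I F e₁ → IsSectionOfImage I F e₂ → ∀ x,
    courant I (applyEndo I F e₁) (applyEndo I F e₂) x + courant I e₁ e₂ x
      = F x (courant I (applyEndo I F e₁) e₂ x + courant I e₁ (applyEndo I F e₂) x)

variable (I F) in
/-- The operator `⟦·, s⟧` commutes with `F` on sections of `im F`. -/
def BracketCommutes (s : ∀ x : M, BigTangent I x) : Prop :=
  ∀ e, IsSectionOfImage I F e → ∀ x, courant I (applyEndo I F e) s x = F x (courant I e s x)

namespace IsAlmostParacontact

variable {e e₁ e₂ s : ∀ x : M, BigTangent I x} {c d : ℝ} {x : M} {p : M × ℝ}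

theorem isSectionOfImage_applyEndo (h : IsAlmostParacontact I F Z ξ) (he : IsSmoothSection I e) :
    IsSectionOfImage I F (applyEndo I F e) :=
  ⟨h.smooth_endo.isSmoothSection he, fun _ => mem_range_self _⟩

theorem applyEndo_applyEndo (h : IsAlmostParacontact I F Z ξ) (he : IsSectionOfImage I F e) :
    applyEndo I F (applyEndo I F e) = e :=
  funext fun x => h.apply_apply_of_mem_range (he.2 x)

theorem exists_sectionOfImage [FiniteDimensional ℝ E] [T2Space M] [SigmaCompactSpace M]
    (h : IsAlmostParacontact I F Z ξ) {a : BigTangent I x} (ha : a ∈ range (F x)) :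
    ∃ e, IsSectionOfImage I F e ∧ e x = a := by
  obtain ⟨b, rfl⟩ := ha
  obtain ⟨e, he, rfl⟩ := exists_smoothSection x b
  exact ⟨applyEndo I F e, h.isSectionOfImage_applyEndo he, rfl⟩

theorem applyEndo_pullBig (h : IsAlmostParacontact I F Z ξ) (he : IsSectionOfImage I F e) :
    applyEndo (I.prod 𝓘(ℝ, ℝ)) (productEndo I F Z ξ) (pullBig I e)
      = pullBig I (applyEndo I F e) :=
  funext fun p => (inclBig_eq_productEndo_inclBig_iff.2
    ⟨rfl, h.snd_vector_of_mem_range (he.2 p.1), h.form_fst_of_mem_range (he.2 p.1)⟩).symm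

theorem courant_mem_range (h : IsAlmostParacontact I F Z ξ) (hs : BracketCommutes I F s)
    (he : IsSectionOfImage I F e) (x : M) : courant I e s x ∈ range (F x) := by
  have := hs _ (h.isSectionOfImage_applyEndo he.1) x
  rw [h.applyEndo_applyEndo he] at this
  exact ⟨_, this.symm⟩

theorem mem_of_productEndo_mem (h : IsAlmostParacontact I F Z ξ)
    {W : Submodule ℝ (BigTangent (I.prod 𝓘(ℝ, ℝ)) p)}
    (hF : ∀ a ∈ range (F p.1), inclBig I p a ∈ W) (hddt : constBig I (-1) 0 p ∈ W)
    (hdt : constBig I 0 1 p ∈ W) (hJ : ∀ w ∈ W, productEndo I F Z ξ p w ∈ W)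
    (v : BigTangent (I.prod 𝓘(ℝ, ℝ)) p) : v ∈ W := by
  have form_mem : inclBig I p (0, ξ p.1) ∈ W :=
    (congrFun (applyEndo_constBig_ddt (F := F)) p).subst (motive := (· ∈ W)) (hJ _ hddt)
  have vector_mem : inclBig I p (Z p.1, 0) ∈ W :=
    (congrFun (applyEndo_constBig_dt (F := F)) p).subst (motive := (· ∈ W)) (hJ _ hdt)
  have inclBig_mem (a : BigTangent I p.1) : inclBig I p a ∈ W := by
    rw [← sub_add_cancel a (ξ p.1 a.1 • (Z p.1, 0) + a.2 (Z p.1) • (0, ξ p.1)), ← h.apply_apply,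
      map_add, map_add, map_smul, map_smul]
    exact W.add_mem (hF _ (mem_range_self _))
      (W.add_mem (W.smul_mem _ vector_mem) (W.smul_mem _ form_mem))
  have constBig_mem (c d : ℝ) : constBig I c d p ∈ W := by
    have : constBig I c d p = (-c) • constBig I (-1) 0 p + d • constBig I 0 1 p := by
      simp only [constBig_eq, zero_smul, zero_add, add_zero, smul_smul, one_smul]
      module
    exact this ▸ W.add_mem (W.smul_mem _ hddt) (W.smul_mem _ hdt)
  rw [← inclBig_projBig_add_constBig p v]
  exact W.add_mem (inclBig_mem _) (constBig_mem _ _)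

theorem bilinear_eq_zero (h : IsAlmostParacontact I F Z ξ)
    {T : BigTangent (I.prod 𝓘(ℝ, ℝ)) p →ₗ[ℝ]
      BigTangent (I.prod 𝓘(ℝ, ℝ)) p →ₗ[ℝ] BigTangent (I.prod 𝓘(ℝ, ℝ)) p}
    (hswap : ∀ a b, T a b = -T b a)
    (hTJ : ∀ a b, T (productEndo I F Z ξ p a) b = -productEndo I F Z ξ p (T a b))
    (hFF : ∀ a ∈ range (F p.1), ∀ b ∈ range (F p.1), T (inclBig I p a) (inclBig I p b) = 0)
    (hFddt : ∀ a ∈ range (F p.1), T (inclBig I p a) (constBig I (-1) 0 p) = 0)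
    (hFdt : ∀ a ∈ range (F p.1), T (inclBig I p a) (constBig I 0 1 p) = 0)
    (hddt_dt : T (constBig I (-1) 0 p) (constBig I 0 1 p) = 0) (v w) : T v w = 0 := by
  have diag (a) : T a a = 0 :=
    have : IsAddTorsionFree (BigTangent (I.prod 𝓘(ℝ, ℝ)) p) :=
      .of_isTorsionFree ℝ (ModelFibre (E × ℝ))
    self_eq_neg.1 (hswap a a)
  have swap {a b} (hab : T a b = 0) : T b a = 0 := by rw [hswap, hab, neg_zero]
  have of_generators (b : BigTangent (I.prod 𝓘(ℝ, ℝ)) p)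
      (hF : ∀ a ∈ range (F p.1), T (inclBig I p a) b = 0)
      (hddt : T (constBig I (-1) 0 p) b = 0) (hdt : T (constBig I 0 1 p) b = 0)
      (v : BigTangent (I.prod 𝓘(ℝ, ℝ)) p) : T v b = 0 := by
    refine h.mem_of_productEndo_mem (W := LinearMap.ker (T.flip b)) hF hddt hdt (fun w hw => ?_) v
    have hw : T w b = 0 := hw
    change T _ b = 0
    rw [hTJ, hw, ContinuousLinearMap.map_zero, neg_zero]
  exact of_generators _
    (fun a ha => swap (of_generators _ (hFF · · a ha) (swap (hFddt a ha)) (swap (hFdt a ha)) _))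
    (swap (of_generators _ hFddt (diag _) (swap hddt_dt) _))
    (swap (of_generators _ hFdt hddt_dt (diag _) _)) _

variable [I.Boundaryless]

theorem torsion_pullBig_eq_zero_iff (h : IsAlmostParacontact I F Z ξ)
    (h₁ : IsSectionOfImage I F e₁) (h₂ : IsSectionOfImage I F e₂) :
    torsion (I.prod 𝓘(ℝ, ℝ)) (productEndo I F Z ξ) (pullBig I e₁) (pullBig I e₂) p = 0 ↔
      inclBig I p (courant I (applyEndo I F e₁) (applyEndo I F e₂) p.1 + courant I e₁ e₂ p.1)
        = productEndo I F Z ξ p (inclBig I p (courant I (applyEndo I F e₁) e₂ p.1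
          + courant I e₁ (applyEndo I F e₂) p.1)) := by
  have d₁ := h₁.1.diffAt p.1
  have d₂ := h₂.1.diffAt p.1
  have Fd₁ := (h.isSectionOfImage_applyEndo h₁.1).1.diffAt p.1
  have Fd₂ := (h.isSectionOfImage_applyEndo h₂.1).1.diffAt p.1
  rw [torsion, h.applyEndo_pullBig h₁, h.applyEndo_pullBig h₂, courant_pullBig Fd₁ Fd₂,
    courant_pullBig Fd₁ d₂, courant_pullBig d₁ Fd₂, courant_pullBig d₁ d₂, ← map_add,
    sub_add_eq_add_sub, ← map_add, sub_eq_zero]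

theorem torsion_pullBig_constBig_eq_zero_iff (h : IsAlmostParacontact I F Z ξ)
    (he : IsSectionOfImage I F e) (hs : DiffAt I s p.1)
    (hcd : applyEndo (I.prod 𝓘(ℝ, ℝ)) (productEndo I F Z ξ) (constBig I c d) = pullBig I s) :
    torsion (I.prod 𝓘(ℝ, ℝ)) (productEndo I F Z ξ) (pullBig I e) (constBig I c d) p = 0 ↔
      inclBig I p (courant I (applyEndo I F e) s p.1)
        = productEndo I F Z ξ p (inclBig I p (courant I e s p.1)) := by
  have de := he.1.diffAt p.1
  have dFe := (h.isSectionOfImage_applyEndo he.1).1.diffAt p.1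
  rw [torsion, h.applyEndo_pullBig he, hcd, courant_pullBig dFe hs, courant_pullBig de hs,
    courant_pullBig_constBig dFe, courant_pullBig_constBig de, zero_add, add_zero, sub_eq_zero]

theorem torsion_pullBig_eq_zero (h : IsAlmostParacontact I F Z ξ) (hF : IsIntegrableOnImage I F)
    (h₁ : IsSectionOfImage I F e₁) (h₂ : IsSectionOfImage I F e₂) (p : M × ℝ) :
    torsion (I.prod 𝓘(ℝ, ℝ)) (productEndo I F Z ξ) (pullBig I e₁) (pullBig I e₂) p = 0 := by
  rw [h.torsion_pullBig_eq_zero_iff h₁ h₂, inclBig_eq_productEndo_inclBig_iff]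
  have mem_range : courant I (applyEndo I F e₁) e₂ p.1 + courant I e₁ (applyEndo I F e₂) p.1
      ∈ range (F p.1) := by
    have := hF _ e₂ (h.isSectionOfImage_applyEndo h₁.1) h₂ p.1
    rw [h.applyEndo_applyEndo h₁, add_comm] at this
    exact ⟨_, this.symm⟩
  exact ⟨hF e₁ e₂ h₁ h₂ p.1, h.snd_vector_of_mem_range mem_range, h.form_fst_of_mem_range mem_range⟩

theorem torsion_pullBig_constBig_eq_zero (h : IsAlmostParacontact I F Z ξ)
    (hFs : BracketCommutes I F s) (he : IsSectionOfImage I F e) (hs : DiffAt I s p.1)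
    (hcd : applyEndo (I.prod 𝓘(ℝ, ℝ)) (productEndo I F Z ξ) (constBig I c d) = pullBig I s) :
    torsion (I.prod 𝓘(ℝ, ℝ)) (productEndo I F Z ξ) (pullBig I e) (constBig I c d) p = 0 := by
  rw [h.torsion_pullBig_constBig_eq_zero_iff he hs hcd, inclBig_eq_productEndo_inclBig_iff]
  have mem_range := h.courant_mem_range hFs he p.1
  exact ⟨hFs e he p.1, h.snd_vector_of_mem_range mem_range, h.form_fst_of_mem_range mem_range⟩

theorem torsion_constBig {s₁ s₂ : ∀ x : M, BigTangent I x} {c₁ d₁ c₂ d₂ : ℝ}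
    (h₁ : applyEndo (I.prod 𝓘(ℝ, ℝ)) (productEndo I F Z ξ) (constBig I c₁ d₁) = pullBig I s₁)
    (h₂ : applyEndo (I.prod 𝓘(ℝ, ℝ)) (productEndo I F Z ξ) (constBig I c₂ d₂) = pullBig I s₂)
    (hs₁ : DiffAt I s₁ p.1) (hs₂ : DiffAt I s₂ p.1) :
    torsion (I.prod 𝓘(ℝ, ℝ)) (productEndo I F Z ξ) (constBig I c₁ d₁) (constBig I c₂ d₂) p
      = inclBig I p (courant I s₁ s₂ p.1) := by
  rw [torsion, h₁, h₂, courant_pullBig hs₁ hs₂, courant_pullBig_constBig hs₁,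
    courant_constBig_pullBig hs₂, courant_constBig, ContinuousLinearMap.map_add,
    ContinuousLinearMap.map_zero, add_zero, add_zero, sub_zero]

theorem exists_torsionTensor_productEndo (h : IsAlmostParacontact I F Z ξ) (p : M × ℝ) :
    ∃ T : BigTangent (I.prod 𝓘(ℝ, ℝ)) p →ₗ[ℝ]
      BigTangent (I.prod 𝓘(ℝ, ℝ)) p →ₗ[ℝ] BigTangent (I.prod 𝓘(ℝ, ℝ)) p,
      (∀ e₁ e₂, DiffAt (I.prod 𝓘(ℝ, ℝ)) e₁ p → DiffAt (I.prod 𝓘(ℝ, ℝ)) e₂ p →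
        torsion (I.prod 𝓘(ℝ, ℝ)) (productEndo I F Z ξ) e₁ e₂ p = T (e₁ p) (e₂ p)) ∧
      (∀ a b, T a b = -T b a) ∧
      ∀ a b, T (productEndo I F Z ξ p a) b = -productEndo I F Z ξ p (T a b) := by
  obtain ⟨F', hF'⟩ := h.smooth_endo.hasEndoRepAt p.1
  exact exists_torsionTensor (fun _ => h.productEndo_productEndo) h.productEndo_skew
    (hF'.productEndo (h.smooth_section.diffAt p.1))

variable [FiniteDimensional ℝ E] [T2Space M] [SigmaCompactSpace M]

theorem extD_form_vector_eq_zero (h : IsAlmostParacontact I F Z ξ)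
    (hZ : BracketCommutes I F (fun y => (Z y, 0))) (x : M) : extD I ξ x (Z x) = 0 := by
  have dZξ := h.smooth_section.diffAt x
  have on_kernel {v : TangentSpace I x} (hv : ξ x v = 0) : extD I ξ x (Z x) v = 0 := by
    obtain ⟨e, he, hex⟩ := h.exists_sectionOfImage (h.mem_range (a := (v, 0)) hv rfl)
    have de := he.1.diffAt x
    have bracket_mem_ker :
        ξ x (VectorField.mlieBracket I Z (fun y => (e y).1) x) = 0 := by
      have := h.form_fst_of_mem_range (h.courant_mem_range hZ he x)
      rw [courant_swap de dZξ.vectorPart] at this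
      exact neg_eq_zero.1 (((ξ x).map_neg _).symm.trans this)
    have cartan := extD_eq_differential_sub_mlieBracket dZξ dZξ de
    rw [hex] at cartan
    refine cartan.trans ?_
    rw [differential_const fun y => h.form_fst_of_mem_range (he.2 y), differential_const h.pairing,
      bracket_mem_ker]
    simp
  refine ContinuousLinearMap.ext fun v => ?_
  have hv : ξ x (v - ξ x v • Z x) = 0 := by
    rw [map_sub, map_smul, h.pairing, smul_eq_mul, mul_one, sub_self]
  calc extD I ξ x (Z x) v
      = extD I ξ x (Z x) (v - ξ x v • Z x) + ξ x v • extD I ξ x (Z x) (Z x) := by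
        rw [map_sub, map_smul, sub_add_cancel]
    _ = 0 := by rw [on_kernel hv, extD_self dZξ, smul_zero, add_zero]

theorem courant_vector_form (h : IsAlmostParacontact I F Z ξ)
    (hZ : BracketCommutes I F (fun y => (Z y, 0))) (x : M) :
    courant I (fun y => (Z y, 0)) (fun y => (0, ξ y)) x = 0 := by
  rw [courant_form_eq_lieForm h.pairing, lieForm, h.extD_form_vector_eq_zero hZ,
    differential_const h.pairing, add_zero]
  rfl

theorem torsion_eq_zero (h : IsAlmostParacontact I F Z ξ)
    (hJ : IsIntegrable (I.prod 𝓘(ℝ, ℝ)) (productEndo I F Z ξ))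
    {e₁ e₂ : ∀ p : M × ℝ, BigTangent (I.prod 𝓘(ℝ, ℝ)) p} (h₁ : DiffAt (I.prod 𝓘(ℝ, ℝ)) e₁ p)
    (h₂ : DiffAt (I.prod 𝓘(ℝ, ℝ)) e₂ p) :
    torsion (I.prod 𝓘(ℝ, ℝ)) (productEndo I F Z ξ) e₁ e₂ p = 0 := by
  obtain ⟨T, hT, -⟩ := h.exists_torsionTensor_productEndo p
  obtain ⟨s₁, hs₁, eq₁⟩ := exists_smoothSection p (e₁ p)
  obtain ⟨s₂, hs₂, eq₂⟩ := exists_smoothSection p (e₂ p)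
  rw [hT _ _ h₁ h₂, ← eq₁, ← eq₂, ← hT _ _ (hs₁.diffAt p) (hs₂.diffAt p)]
  exact hJ _ _ hs₁ hs₂ p

theorem isIntegrableOnImage (h : IsAlmostParacontact I F Z ξ)
    (hJ : IsIntegrable (I.prod 𝓘(ℝ, ℝ)) (productEndo I F Z ξ)) : IsIntegrableOnImage I F := by
  intro e₁ e₂ h₁ h₂ x
  have torsion_eq_zero (p : M × ℝ) :=
    h.torsion_eq_zero hJ (h₁.1.diffAt p.1).pullBig (h₂.1.diffAt p.1).pullBig
  simp only [h.torsion_pullBig_eq_zero_iff h₁ h₂, inclBig_eq_productEndo_inclBig_iff]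
    at torsion_eq_zero
  exact (torsion_eq_zero (x, 0)).1

theorem bracketCommutes (h : IsAlmostParacontact I F Z ξ)
    (hJ : IsIntegrable (I.prod 𝓘(ℝ, ℝ)) (productEndo I F Z ξ)) (hs : ∀ x, DiffAt I s x)
    (hcd : applyEndo (I.prod 𝓘(ℝ, ℝ)) (productEndo I F Z ξ) (constBig I c d) = pullBig I s) :
    BracketCommutes I F s := by
  intro e he x
  have torsion_eq_zero (p : M × ℝ) :=
    h.torsion_eq_zero hJ (he.1.diffAt p.1).pullBig (diffAt_constBig c d p)
  simp only [h.torsion_pullBig_constBig_eq_zero_iff he (hs _) hcd,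
    inclBig_eq_productEndo_inclBig_iff] at torsion_eq_zero
  exact (torsion_eq_zero (x, 0)).1

theorem isIntegrable (h : IsAlmostParacontact I F Z ξ) (hF : IsIntegrableOnImage I F)
    (hZ : BracketCommutes I F (fun y => (Z y, 0)))
    (hξ : BracketCommutes I F (fun y => (0, ξ y))) :
    IsIntegrable (I.prod 𝓘(ℝ, ℝ)) (productEndo I F Z ξ) := by
  intro s₁ s₂ hs₁ hs₂ p
  obtain ⟨T, hT, hswap, hTJ⟩ := h.exists_torsionTensor_productEndo p
  have dZ := (h.smooth_section.diffAt p.1).vectorPart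
  have dξ := (h.smooth_section.diffAt p.1).formPart
  refine (hT _ _ (hs₁.diffAt p) (hs₂.diffAt p)).trans
    (h.bilinear_eq_zero hswap hTJ (fun a ha b hb => ?_) (fun a ha => ?_) (fun a ha => ?_) ?_ _ _)
  · obtain ⟨e₁, he₁, rfl⟩ := h.exists_sectionOfImage ha
    obtain ⟨e₂, he₂, rfl⟩ := h.exists_sectionOfImage hb
    exact (hT _ _ (he₁.1.diffAt p.1).pullBig (he₂.1.diffAt p.1).pullBig).symm.trans
      (h.torsion_pullBig_eq_zero hF he₁ he₂ p)
  · obtain ⟨e, he, rfl⟩ := h.exists_sectionOfImage ha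
    exact (hT _ _ (he.1.diffAt p.1).pullBig (diffAt_constBig _ _ p)).symm.trans
      (h.torsion_pullBig_constBig_eq_zero hξ he dξ applyEndo_constBig_ddt)
  · obtain ⟨e, he, rfl⟩ := h.exists_sectionOfImage ha
    exact (hT _ _ (he.1.diffAt p.1).pullBig (diffAt_constBig _ _ p)).symm.trans
      (h.torsion_pullBig_constBig_eq_zero hZ he dZ applyEndo_constBig_dt)
  · rw [← hT _ _ (diffAt_constBig (-1) 0 p) (diffAt_constBig 0 1 p),
      torsion_constBig applyEndo_constBig_ddt applyEndo_constBig_dt dξ dZ, courant_swap dξ dZ,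
      h.courant_vector_form hZ, neg_zero, ContinuousLinearMap.map_zero]

theorem isIntegrable_iff (h : IsAlmostParacontact I F Z ξ) :
    IsIntegrable (I.prod 𝓘(ℝ, ℝ)) (productEndo I F Z ξ) ↔ IsIntegrableOnImage I F ∧
      BracketCommutes I F (fun y => (Z y, 0)) ∧ BracketCommutes I F (fun y => (0, ξ y)) :=
  ⟨fun hJ => ⟨h.isIntegrableOnImage hJ,
    h.bracketCommutes hJ (fun x => (h.smooth_section.diffAt x).vectorPart) applyEndo_constBig_dt,
    h.bracketCommutes hJ (fun x => (h.smooth_section.diffAt x).formPart) applyEndo_constBig_ddt⟩,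
  fun ⟨hF, hZ, hξ⟩ => h.isIntegrable hF hZ hξ⟩

end IsAlmostParacontact

end Integrability

section Characterization

variable {E : Type*} [NormedAddCommGroup E] [NormedSpace ℝ E]
  {H : Type*} [TopologicalSpace H] {I : ModelWithCorners ℝ E H}
  {M : Type*} [TopologicalSpace M] [ChartedSpace H M]
  {F : ∀ x : M, BigTangent I x →L[ℝ] BigTangent I x} {Z : ∀ x : M, TangentSpace I x}
  {ξ : ∀ x : M, CotangentSpace I x} {x : M}

theorem metricNorm_pair (X : TangentSpace I x) (α : CotangentSpace I x) :
    metricNorm I (x := x) (X, α) = √|α X| := by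
  rw [metricNorm, metric]
  congr 2
  ring

theorem pairing_ne_zero {X : TangentSpace I x} {α : CotangentSpace I x}
    (h : metricNorm I (x := x) (X, α) = 1) : α X ≠ 0 := fun pairing_zero => by
  rw [metricNorm_pair, pairing_zero, abs_zero, Real.sqrt_zero] at h
  exact zero_ne_one h

theorem flat_add_transpose_eq_zero_iff {A : BigTangent I x →L[ℝ] BigTangent I x}
    {a : BigTangent I x} :
    flat I (A a) + transpose I A (flat I a) = 0 ↔
      ∀ b, metric I (A a) b + metric I a (A b) = 0 := by
  have apply (b : BigTangent I x) : (flat I (A a) + transpose I A (flat I a)) b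
      = metric I (A a) b + metric I a (A b) :=
    congrArg₂ (· + ·) (flat_apply I (A a) b) (flat_apply I a (A b))
  refine ⟨fun h b => ?_, fun h => ContinuousLinearMap.ext fun b => (apply b).trans (h b)⟩
  rw [← apply, h]
  rfl

theorem apply_vector_of_comp_frakZ (hne : ξ x (Z x) ≠ 0) (h : (F x).comp (frakZ I Z ξ x) = 0) :
    F x (Z x, 0) = 0 := by
  have frakZ_vector : frakZ I Z ξ x (Z x, 0) = ξ x (Z x) • (Z x, 0) :=
    Prod.ext rfl ((zero_smul ℝ (ξ x)).trans (smul_zero (ξ x (Z x))).symm)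
  have apply_frakZ : F x (frakZ I Z ξ x (Z x, 0)) = 0 := DFunLike.congr_fun h _
  rw [frakZ_vector, ContinuousLinearMap.map_smul] at apply_frakZ
  exact (smul_eq_zero.1 apply_frakZ).resolve_left hne

theorem apply_form_of_comp_frakZ (hne : ξ x (Z x) ≠ 0) (h : (F x).comp (frakZ I Z ξ x) = 0) :
    F x (0, ξ x) = 0 := by
  have frakZ_form : frakZ I Z ξ x (0, ξ x) = ξ x (Z x) • (0, ξ x) := by
    refine Prod.ext ?_ rfl
    change ξ x 0 • Z x = ξ x (Z x) • (0 : TangentSpace I x)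
    rw [map_zero, zero_smul, smul_zero]
  have apply_frakZ : F x (frakZ I Z ξ x (0, ξ x)) = 0 := DFunLike.congr_fun h _
  rw [frakZ_form, ContinuousLinearMap.map_smul] at apply_frakZ
  exact (smul_eq_zero.1 apply_frakZ).resolve_left hne

theorem pairing_eq_one_of_sq (hne : ξ x (Z x) ≠ 0) (hZ : F x (Z x, 0) = 0)
    (hsq : (F x).comp (F x) = ContinuousLinearMap.id ℝ _ - frakZ I Z ξ x) : ξ x (Z x) = 1 := by
  have sq_vector : F x (F x (Z x, 0)) = (Z x, 0) - frakZ I Z ξ x (Z x, 0) :=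
    DFunLike.congr_fun hsq _
  rw [hZ, ContinuousLinearMap.map_zero] at sq_vector
  have vector_eq : (0 : TangentSpace I x) = Z x - ξ x (Z x) • Z x := congrArg Prod.fst sq_vector
  have pairing_eq := congrArg (ξ x) vector_eq
  rw [map_zero, map_sub, map_smul, smul_eq_mul] at pairing_eq
  exact mul_left_cancel₀ hne (by linarith)

variable [IsManifold I ∞ M]

theorem isAlmostParacontact_iff (hF : IsSmoothEndo I F)
    (hZξ : IsSmoothSection I (fun x => (Z x, ξ x))) :
    IsAlmostParacontact I F Z ξ ↔
      (∀ x, (F x).comp (F x) = ContinuousLinearMap.id ℝ _ - frakZ I Z ξ x) ∧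
      (∀ x : M, metricNorm I (x := x) (Z x, ξ x) = 1) ∧
      (∀ (x : M) (a : BigTangent I x),
        flat I (F x a) + transpose I (F x) (flat I a) = 0) ∧
      ∀ x, (F x).comp (frakZ I Z ξ x) = 0 := by
  constructor
  · intro h
    refine ⟨h.sq, fun x => ?_, fun x a => flat_add_transpose_eq_zero_iff.2 (h.skew x a),
      fun x => ContinuousLinearMap.ext fun a => ?_⟩
    · rw [metricNorm_pair, h.pairing, abs_one, Real.sqrt_one]
    · change F x (frakZ I Z ξ x a) = 0
      rw [frakZ_eq_add, ContinuousLinearMap.map_add, ContinuousLinearMap.map_smul,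
        ContinuousLinearMap.map_smul, h.apply_vector, h.apply_form, smul_zero, smul_zero, add_zero]
  · rintro ⟨hsq, hnorm, hflat, hcomp⟩
    have hne (x : M) := pairing_ne_zero (hnorm x)
    have hZ (x : M) := apply_vector_of_comp_frakZ (hne x) (hcomp x)
    exact ⟨hF, hZξ, fun x a => flat_add_transpose_eq_zero_iff.1 (hflat x a),
      fun x => pairing_eq_one_of_sq (hne x) (hZ x) (hsq x),
      fun x => apply_form_of_comp_frakZ (hne x) (hcomp x), hZ, hsq⟩

namespace IsAlmostParacontact

theorem nijenhuis_eq_iff (h : IsAlmostParacontact I F Z ξ) :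
    (∀ e₁ e₂, IsSectionOfImage I F e₁ → IsSectionOfImage I F e₂ → ∀ x,
        nijenhuis I F e₁ e₂ x = -frakZ I Z ξ x (courant I e₁ e₂ x)) ↔
      IsIntegrableOnImage I F := by
  have sq_apply (x : M) (a : BigTangent I x) : F x (F x a) = a - frakZ I Z ξ x a :=
    DFunLike.congr_fun (h.sq x) a
  refine forall₅_congr fun e₁ e₂ _ _ x => ?_
  rw [nijenhuis, sq_apply, ← add_sub_assoc, sub_eq_neg_self, sub_add_eq_add_sub, sub_eq_zero]

theorem courant_form_eq_iff (h : IsAlmostParacontact I F Z ξ) :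
    (∀ e, IsSectionOfImage I F e → ∀ x, courant I (applyEndo I F e) (fun y => (0, ξ y)) x
        = F x (0, lieForm I (fun y => (e y).1) ξ x)) ↔
      BracketCommutes I F (fun y => (0, ξ y)) := by
  refine forall₃_congr fun e he x => ?_
  rw [← courant_form_eq_lieForm fun y => h.form_fst_of_mem_range (he.2 y)]

theorem courant_vector_eq_iff [I.Boundaryless] (h : IsAlmostParacontact I F Z ξ) :
    (∀ e, IsSectionOfImage I F e → ∀ x,
        courant I (fun y => (Z y, 0)) (applyEndo I F e) x = F x (lieBig I Z e x)) ↔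
      BracketCommutes I F (fun y => (Z y, 0)) := by
  refine forall₃_congr fun e he x => ?_
  have dZ := (h.smooth_section.diffAt x).vectorPart
  rw [← courant_vector_eq_lieBig fun y => h.snd_vector_of_mem_range (he.2 y),
    courant_swap dZ ((h.isSectionOfImage_applyEndo he.1).1.diffAt x),
    courant_swap dZ (he.1.diffAt x), ContinuousLinearMap.map_neg]
  exact neg_inj

end IsAlmostParacontact

end Characterization

end GenParacontact

end

open GenParacontact in
theorem theorem3p2_general {E : Type*} [NormedAddCommGroup E] [NormedSpace ℝ E]
    [FiniteDimensional ℝ E] {H : Type*} [TopologicalSpace H] {I : ModelWithCorners ℝ E H}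
    [I.Boundaryless] {M : Type*} [TopologicalSpace M] [ChartedSpace H M] [IsManifold I ∞ M]
    [T2Space M] [SigmaCompactSpace M] {F : ∀ x : M, BigTangent I x →L[ℝ] BigTangent I x}
    (hF : IsSmoothEndo I F) {Z : ∀ x : M, TangentSpace I x} {ξ : ∀ x : M, CotangentSpace I x}
    (hZξ : IsSmoothSection I (fun x => (Z x, ξ x))) :
    IsNormalParacontact I F Z ξ ↔
      ((∀ x, (F x).comp (F x) = ContinuousLinearMap.id ℝ _ - frakZ I Z ξ x) ∧
        (∀ e₁ e₂, IsSectionOfImage I F e₁ → IsSectionOfImage I F e₂ → ∀ x,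
          nijenhuis I F e₁ e₂ x = -frakZ I Z ξ x (courant I e₁ e₂ x))) ∧
      ((∀ x : M, metricNorm I (x := x) (Z x, ξ x) = 1) ∧
        (∀ e, IsSectionOfImage I F e → ∀ x,
          courant I (fun y => (Z y, 0)) (applyEndo I F e) x = F x (lieBig I Z e x))) ∧
      ((∀ (x : M) (a : BigTangent I x), flat I (F x a) + transpose I (F x) (flat I a) = 0) ∧
        (∀ x, (F x).comp (frakZ I Z ξ x) = 0) ∧
        (∀ e, IsSectionOfImage I F e → ∀ x,
          courant I (applyEndo I F e) (fun y => (0, ξ y)) x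
            = F x (0, lieForm I (fun y => (e y).1) ξ x))) := by
  constructor
  · rintro ⟨h, hJ⟩
    obtain ⟨hFF, hFZ, hFξ⟩ := h.isIntegrable_iff.1 hJ
    obtain ⟨hsq, hnorm, hflat, hcomp⟩ := (isAlmostParacontact_iff hF hZξ).1 h
    exact ⟨⟨hsq, h.nijenhuis_eq_iff.2 hFF⟩, ⟨hnorm, h.courant_vector_eq_iff.2 hFZ⟩,
      hflat, hcomp, h.courant_form_eq_iff.2 hFξ⟩
  · rintro ⟨⟨hsq, hFF⟩, ⟨hnorm, hFZ⟩, hflat, hcomp, hFξ⟩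
    have h := (isAlmostParacontact_iff hF hZξ).2 ⟨hsq, hnorm, hflat, hcomp⟩
    exact ⟨h, h.isIntegrable_iff.2 ⟨h.nijenhuis_eq_iff.1 hFF, h.courant_vector_eq_iff.1 hFZ,
      h.courant_form_eq_iff.1 hFξ⟩⟩

/-- Characterization of generalized normal para-contact structures on an odd-dimensional manifold:
`F` is a smooth endomorphism of `TM ⊕ T*M`, `(Z, ξ)` a smooth section of it and `𝔷 = Z ⊙ ξ`. -/
theorem theorem3p2 {n : ℕ} {M : Type*} [TopologicalSpace M]
    [ChartedSpace (EuclideanSpace ℝ (Fin (2 * n + 1))) M]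
    [IsManifold (𝓡 (2 * n + 1)) ∞ M] [T2Space M] [SecondCountableTopology M]
    (F : ∀ x : M, GenParacontact.BigTangent (𝓡 (2 * n + 1)) x →L[ℝ]
      GenParacontact.BigTangent (𝓡 (2 * n + 1)) x)
    (hF : GenParacontact.IsSmoothEndo (𝓡 (2 * n + 1)) F)
    (Z : ∀ x : M, TangentSpace (𝓡 (2 * n + 1)) x)
    (ξ : ∀ x : M, GenParacontact.CotangentSpace (𝓡 (2 * n + 1)) x)
    (hZξ : GenParacontact.IsSmoothSection (𝓡 (2 * n + 1)) (fun x => (Z x, ξ x))) :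
    GenParacontact.IsNormalParacontact (𝓡 (2 * n + 1)) F Z ξ ↔
      -- (i) `F² = I - 𝔷`, and `N_F = -𝔷 ⟦·, ·⟧` on sections of `im F`
      ((∀ x, (F x).comp (F x) =
          ContinuousLinearMap.id ℝ _ - GenParacontact.frakZ (𝓡 (2 * n + 1)) Z ξ x) ∧
        (∀ e₁ e₂, GenParacontact.IsSectionOfImage (𝓡 (2 * n + 1)) F e₁ →
          GenParacontact.IsSectionOfImage (𝓡 (2 * n + 1)) F e₂ → ∀ x,
          GenParacontact.nijenhuis (𝓡 (2 * n + 1)) F e₁ e₂ x =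
            -GenParacontact.frakZ (𝓡 (2 * n + 1)) Z ξ x
              (GenParacontact.courant (𝓡 (2 * n + 1)) e₁ e₂ x))) ∧
      -- (ii) `‖Z ⊕ ξ‖_g = 1`, and `⟦(Z, 0), F e⟧ = F (L_Z e)` for sections `e` of `im F`
      ((∀ x : M, GenParacontact.metricNorm (𝓡 (2 * n + 1)) (x := x) (Z x, ξ x) = 1) ∧
        (∀ e, GenParacontact.IsSectionOfImage (𝓡 (2 * n + 1)) F e → ∀ x,
          GenParacontact.courant (𝓡 (2 * n + 1)) (fun y => (Z y, 0))
              (GenParacontact.applyEndo (𝓡 (2 * n + 1)) F e) x =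
            F x (GenParacontact.lieBig (𝓡 (2 * n + 1)) Z e x))) ∧
      -- (iii) `♭_g ∘ F + F^t ∘ ♭_g = 0`, `F ∘ 𝔷 = 0`, and `⟦F (X, α), (0, ξ)⟧ = F (0, L_X ξ)` for
      -- sections `(X, α)` of `im F`
      ((∀ (x : M) (a : GenParacontact.BigTangent (𝓡 (2 * n + 1)) x),
          GenParacontact.flat (𝓡 (2 * n + 1)) (F x a) +
            GenParacontact.transpose (𝓡 (2 * n + 1)) (F x)
              (GenParacontact.flat (𝓡 (2 * n + 1)) a) = 0) ∧
        (∀ x, (F x).comp (GenParacontact.frakZ (𝓡 (2 * n + 1)) Z ξ x) = 0) ∧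
        (∀ e, GenParacontact.IsSectionOfImage (𝓡 (2 * n + 1)) F e → ∀ x,
          GenParacontact.courant (𝓡 (2 * n + 1))
              (GenParacontact.applyEndo (𝓡 (2 * n + 1)) F e) (fun y => (0, ξ y)) x =
            F x (0, GenParacontact.lieForm (𝓡 (2 * n + 1)) (fun y => (e y).1) ξ x))) := by
  have : LocallyCompactSpace M :=
    ChartedSpace.locallyCompactSpace (EuclideanSpace ℝ (Fin (2 * n + 1))) M
  exact theorem3p2_general hF hZξ
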